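/- **Theorem 1.** Let $d\ge 2$, and let $V:\mathbb{C}^d\to\mathbb{C}^d\otimes\mathbb{C}^d$ be an isometry. *The semicontinuous limit.* A standard dyadic interval is an interval $[p/2^n,(p+1)/2^n]\subseteq[0,1]$ with integers $p,n\ge 0$. Let $\mathcal{D}$ be the set of partitions $\mathcal{I}$ of $[0,1]$ into finitely many standard dyadic intervals, and write $\mathcal{I}\preceq\mathcal{J}$ if every interval of $\mathcal{I}$ is a union of intervals of $\mathcal{J}$. For $\mathcal{I}\in\mathcal{D}$ let $\mathcal{H}_{\mathcal{I}}=(\mathbb{C}^d)^{\otimes\mathcal{I}}$. For $\mathcal{I}\preceq\mathcal{J}$, subdividing the intervals of $\mathcal{I}$ by successive halving until the intervals of $\mathcal{J}$ are reached, and applying $V$ to the tensor factor of an interval each time this interval is halved (the two factors of the result belonging to the left and the right half), gives an isometry $\iota^V_{\mathcal{J},\mathcal{I}}:\mathcal{H}_{\mathcal{I}}\to\mathcal{H}_{\mathcal{J}}$. Let $\mathcal{H}$ be the Hilbert space completion of the disjoint union of the $\mathcal{H}_{\mathcal{I}}$ modulo the relation that identifies $\Psi\in\mathcal{H}_{\mathcal{I}}$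 and $\Phi\in\mathcal{H}_{\mathcal{J}}$ if $\iota^V_{\mathcal{K},\mathcal{I}}\Psi=\iota^V_{\mathcal{K},\mathcal{J}}\Phi$ for some $\mathcal{K}$ with $\mathcal{I}\preceq\mathcal{K}$ and $\mathcal{J}\preceq\mathcal{K}$; inner products are computed after refining to a common partition. *The representation.* The Thompson group $\mathsf{T}$ consists of the piecewise linear homeomorphisms of the circle $S^1=[0,1]/(0\sim 1)$ that map dyadic rationals to dyadic rationals, are differentiable except at finitely many dyadic rationals, and have integer powers of $2$ as slopes. Jones' unitary representation $\rho^V$ of $\mathsf{T}$ on $\mathcal{H}$ is determined by $\rho^V(f)[\Psi]=[\Psi']$ whenever $\Psi\in\mathcal{H}_{\mathcal{I}}$ and $f$ maps each interval of $\mathcal{I}$ affinely onto an interval of some $\mathcal{J}\in\mathcal{D}$ with $\mathcal{J}=f(\mathcal{I})$, where $\Psi'\in\mathcal{H}_{\mathcal{J}}$ results from $\Psi$ by relabelling the tensor factors according to $f$; every $\mathcal{I}\in\mathcal{D}$ has a refinement with this property. *Claim.* For all isometries $V:\mathbb{C}^d\to\mathbb{C}^d\otimes\mathbb{C}^d$ outside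 a set of Haar measure zero (the Haar measure on isometries being the distribution of the first $d$ columns of a Haar random unitary matrix in $\mathsf{U}(d^2)$), the representation $\rho^V$ is weakly discontinuous at the identity: there are a sequence $(f_k)_{k\in\mathbb{N}}$ in $\mathsf{T}$ with $\lim_{k\to\infty}\|f_k-\mathrm{id}\|_\infty=0$ (the supremum over $S^1$ of the distance in the circle) and vectors $\Phi,\Psi\in\mathcal{H}$ such that $\langle\Phi,\rho^V(f_k)\Psi\rangle$ does not converge to $\langle\Phi,\Psi\rangle$. -/

import Mathlib

open Set Filter Topology MeasureTheory

noncomputable section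

namespace ThompsonTree

/-! ### Standard dyadic intervals and partitions -/

/-- The standard dyadic interval `[p / 2 ^ n, (p + 1) / 2 ^ n] ⊆ [0, 1]`, with `n = level` and
`p = idx`. -/
@[ext] structure DyadicInterval where
  level : ℕ
  idx : ℕ
  idx_lt : idx < 2 ^ level

instance : DecidableEq DyadicInterval := Classical.decEq _

namespace DyadicInterval

/-- The left endpoint. -/
def left (i : DyadicInterval) : ℝ := i.idx / 2 ^ i.level

/-- The length. -/
def len (i : DyadicInterval) : ℝ := 1 / 2 ^ i.level

/-- The underlying set of points. The right endpoint is left out, so that a subdivision of the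
circle `[0, 1] / (0 = 1)` into standard dyadic intervals is literally a partition. -/
def toSet (i : DyadicInterval) : Set ℝ := Ico i.left (i.left + i.len)

/-- The left half. -/
def fst (i : DyadicInterval) : DyadicInterval where
  level := i.level + 1
  idx := 2 * i.idx
  idx_lt := by have := i.idx_lt; rw [pow_succ]; omega

/-- The right half. -/
def snd (i : DyadicInterval) : DyadicInterval where
  level := i.level + 1
  idx := 2 * i.idx + 1
  idx_lt := by have := i.idx_lt; rw [pow_succ]; omega

/-- The interval of level `n` that contains `x`. -/
def around (n : ℕ) (x : ℝ) (hx : x ∈ Ico (0 : ℝ) 1) : DyadicInterval where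
  level := n
  idx := ⌊x * 2 ^ n⌋₊
  idx_lt := by
    have h0 : (0 : ℝ) < 2 ^ n := by positivity
    rw [Nat.floor_lt (by have := hx.1; positivity)]
    push_cast
    nlinarith [hx.2]

lemma len_pos (i : DyadicInterval) : 0 < i.len := by unfold len; positivity

lemma left_nonneg (i : DyadicInterval) : 0 ≤ i.left := by unfold left; positivity

lemma left_add_len_le (i : DyadicInterval) : i.left + i.len ≤ 1 := by
  unfold left len
  rw [← add_div, div_le_one (by positivity)]
  have := i.idx_lt
  exact_mod_cast this

lemma left_mem (i : DyadicInterval) : i.left ∈ i.toSet := ⟨le_rfl, by have := i.len_pos; linarith⟩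

lemma toSet_subset (i : DyadicInterval) : i.toSet ⊆ Ico 0 1 := fun _ hx =>
  ⟨i.left_nonneg.trans hx.1, hx.2.trans_le i.left_add_len_le⟩

lemma mem_toSet {i : DyadicInterval} {x : ℝ} (hx : 0 ≤ x) :
    x ∈ i.toSet ↔ ⌊x * 2 ^ i.level⌋₊ = i.idx := by
  have h0 : (0 : ℝ) < 2 ^ i.level := by positivity
  rw [Nat.floor_eq_iff (by positivity)]
  unfold toSet left len
  rw [← add_div, mem_Ico, div_le_iff₀ h0, lt_div_iff₀ h0]

lemma mem_around (n : ℕ) (x : ℝ) (hx : x ∈ Ico (0 : ℝ) 1) : x ∈ (around n x hx).toSet := by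
  rw [mem_toSet hx.1]; rfl

lemma floor_level (x : ℝ) {n m : ℕ} (h : n ≤ m) :
    ⌊x * 2 ^ n⌋₊ = ⌊x * 2 ^ m⌋₊ / 2 ^ (m - n) := by
  have := Nat.floor_div_natCast (x * 2 ^ m) (2 ^ (m - n))
  rw [← this]
  congr 1
  push_cast
  rw [eq_div_iff (by positivity), mul_assoc, ← pow_add]
  congr 2
  omega

lemma subset_of_mem {i j : DyadicInterval} {x : ℝ} (hi : x ∈ i.toSet) (hj : x ∈ j.toSet)
    (h : i.level ≤ j.level) : j.toSet ⊆ i.toSet := by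
  intro y hy
  have hx0 := (i.toSet_subset hi).1
  have hy0 := (j.toSet_subset hy).1
  rw [mem_toSet hx0] at hi hj
  rw [mem_toSet hy0] at hy ⊢
  rw [floor_level _ h] at hi ⊢
  rw [hy, ← hi, hj]

lemma eq_of_mem {i j : DyadicInterval} {x : ℝ} (hi : x ∈ i.toSet) (hj : x ∈ j.toSet)
    (h : i.level = j.level) : i = j := by
  have hx0 := (i.toSet_subset hi).1
  rw [mem_toSet hx0] at hi hj
  ext
  · exact h
  · rw [← hi, ← hj, h]

lemma fst_left (i : DyadicInterval) : i.fst.left = i.left := by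
  simp only [fst, left, pow_succ]; push_cast; field_simp

lemma fst_len (i : DyadicInterval) : i.fst.len = i.len / 2 := by
  simp only [fst, len, pow_succ]; field_simp

lemma snd_left (i : DyadicInterval) : i.snd.left = i.left + i.len / 2 := by
  simp only [snd, left, len, pow_succ]; push_cast; field_simp

lemma snd_len (i : DyadicInterval) : i.snd.len = i.len / 2 := by
  simp only [snd, len, pow_succ]; field_simp

lemma mem_fst_or_snd {i : DyadicInterval} {x : ℝ} :
    x ∈ i.toSet ↔ x ∈ i.fst.toSet ∨ x ∈ i.snd.toSet := by
  have := i.len_pos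
  simp only [toSet, mem_Ico, fst_left, fst_len, snd_left, snd_len]
  constructor
  · rintro ⟨h1, h2⟩
    rcases lt_or_ge x (i.left + i.len / 2) with h | h
    · exact Or.inl ⟨h1, h⟩
    · exact Or.inr ⟨h, by linarith⟩
  · rintro (⟨h1, h2⟩ | ⟨h1, h2⟩) <;> constructor <;> linarith

lemma fst_subset (i : DyadicInterval) : i.fst.toSet ⊆ i.toSet :=
  fun _ h => mem_fst_or_snd.2 (Or.inl h)

lemma snd_subset (i : DyadicInterval) : i.snd.toSet ⊆ i.toSet :=
  fun _ h => mem_fst_or_snd.2 (Or.inr h)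

lemma fst_ne_snd (i : DyadicInterval) : i.fst ≠ i.snd := by
  intro h
  have := congrArg idx h
  simp only [fst, snd] at this
  omega

lemma not_mem_fst_snd {i : DyadicInterval} {x : ℝ} (h1 : x ∈ i.fst.toSet) (h2 : x ∈ i.snd.toSet) :
    False := i.fst_ne_snd (eq_of_mem h1 h2 rfl)

lemma level_le_of_subset {i j : DyadicInterval} (h : j.toSet ⊆ i.toSet) : i.level ≤ j.level := by
  by_contra hlt
  push Not at hlt
  have hj := subset_of_mem j.left_mem (h j.left_mem) hlt.le
  have hlen : i.len < j.len := by
    unfold len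
    exact one_div_lt_one_div_of_lt (by positivity) (pow_lt_pow_right₀ (by norm_num) hlt)
  have := (Ico_subset_Ico_iff (by have := j.len_pos; linarith)).1 h
  linarith [this.1, this.2]

lemma eq_of_subset {i j : DyadicInterval} (h : j.toSet ⊆ i.toSet) (h' : i.toSet ⊆ j.toSet) :
    i = j :=
  eq_of_mem (h j.left_mem) j.left_mem (le_antisymm (level_le_of_subset h) (level_le_of_subset h'))

lemma subset_half {i j : DyadicInterval} (h : j.toSet ⊆ i.toSet) (hne : j ≠ i) :
    i.level < j.level ∧ (j.toSet ⊆ i.fst.toSet ∨ j.toSet ⊆ i.snd.toSet) := by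
  have hl : i.level < j.level := by
    refine lt_of_le_of_ne (level_le_of_subset h) fun he => hne ?_
    exact (eq_of_mem (h j.left_mem) j.left_mem he).symm
  refine ⟨hl, ?_⟩
  rcases mem_fst_or_snd.1 (h j.left_mem) with h1 | h1
  · exact Or.inl (subset_of_mem h1 j.left_mem hl)
  · exact Or.inr (subset_of_mem h1 j.left_mem hl)

/-- A property that passes to halves passes to all dyadic subintervals. -/
lemma descend {P : DyadicInterval → Prop} (h1 : ∀ i, P i → P i.fst) (h2 : ∀ i, P i → P i.snd)
    {i j : DyadicInterval} (hi : P i) (h : j.toSet ⊆ i.toSet) : P j := by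
  obtain ⟨n, hn⟩ : ∃ n, n = j.level - i.level := ⟨_, rfl⟩
  induction n generalizing i with
  | zero =>
    by_cases hne : j = i
    · exact hne ▸ hi
    · have := (subset_half h hne).1
      omega
  | succ n ih =>
    by_cases hne : j = i
    · exact hne ▸ hi
    · rcases subset_half h hne with ⟨hl, h' | h'⟩
      · exact ih (h1 _ hi) h' (by simp only [fst]; omega)
      · exact ih (h2 _ hi) h' (by simp only [snd]; omega)

end DyadicInterval

/-- A partition `𝓘` of `[0, 1]` into finitely many standard dyadic intervals. -/
structure DyadicPartition where
  parts : Finset DyadicInterval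
  existsUnique_mem : ∀ x ∈ Ico (0 : ℝ) 1, ∃! i, i ∈ parts ∧ x ∈ i.toSet

namespace DyadicPartition

/-- `I ≤ J` if `J` refines `I`: every interval of `I` is a union of intervals of `J`. -/
instance : Preorder DyadicPartition where
  le I J := ∀ i ∈ I.parts, ∃ S ⊆ J.parts, i.toSet = ⋃ j ∈ S, j.toSet
  le_refl I i hi := ⟨{i}, by simpa using hi, by simp⟩
  le_trans I J K hIJ hJK i hi := by
    obtain ⟨S, hS, hiS⟩ := hIJ i hi
    choose! T hT hT' using hJK
    refine ⟨S.biUnion T, ?_, ?_⟩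
    · intro k hk
      obtain ⟨j, hj, hk⟩ := Finset.mem_biUnion.1 hk
      exact hT j (hS hj) hk
    · rw [hiS, Finset.set_biUnion_biUnion]
      exact iUnion₂_congr fun j hj => hT' j (hS hj)

lemma eq_of_mem (I : DyadicPartition) {i j : DyadicInterval} {x : ℝ} (hi : i ∈ I.parts)
    (hj : j ∈ I.parts) (hxi : x ∈ i.toSet) (hxj : x ∈ j.toSet) : i = j :=
  (I.existsUnique_mem x (i.toSet_subset hxi)).unique ⟨hi, hxi⟩ ⟨hj, hxj⟩

lemma ext_of_subset {I J : DyadicPartition} (h : I.parts ⊆ J.parts) : I = J := by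
  have : I.parts = J.parts := by
    refine h.antisymm fun j hj => ?_
    obtain ⟨i, ⟨hi, hx⟩, -⟩ := I.existsUnique_mem _ (j.toSet_subset j.left_mem)
    exact J.eq_of_mem hj (h hi) j.left_mem hx ▸ hi
  cases I; cases J; simpa using this

lemma le_iff {I J : DyadicPartition} :
    I ≤ J ↔ ∀ j ∈ J.parts, ∃ i ∈ I.parts, j.toSet ⊆ i.toSet := by
  constructor
  · intro h j hj
    obtain ⟨i, ⟨hi, hx⟩, -⟩ := I.existsUnique_mem _ (j.toSet_subset j.left_mem)
    obtain ⟨S, hS, hiS⟩ := h i hi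
    refine ⟨i, hi, ?_⟩
    have hx' := hx
    rw [hiS] at hx'
    simp only [mem_iUnion] at hx'
    obtain ⟨j', hj', hxj'⟩ := hx'
    rw [J.eq_of_mem hj (hS hj') j.left_mem hxj', hiS]
    exact subset_biUnion_of_mem (u := fun j : DyadicInterval => j.toSet) hj'
  · intro h i hi
    classical
    refine ⟨J.parts.filter fun j => j.toSet ⊆ i.toSet, Finset.filter_subset _ _, ?_⟩
    apply Subset.antisymm
    · intro x hx
      obtain ⟨j, ⟨hj, hxj⟩, -⟩ := J.existsUnique_mem x (i.toSet_subset hx)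
      obtain ⟨i', hi', hji'⟩ := h j hj
      simp only [mem_iUnion, Finset.mem_filter]
      exact ⟨j, ⟨hj, I.eq_of_mem hi hi' hx (hji' hxj) ▸ hji'⟩, hxj⟩
    · refine iUnion₂_subset fun j hj => ?_
      exact (Finset.mem_filter.1 hj).2

/-- The partition into `2 ^ n` intervals of equal length. -/
def uniform (n : ℕ) : DyadicPartition where
  parts := Finset.univ.image fun p : Fin (2 ^ n) => ⟨n, p, p.2⟩
  existsUnique_mem x hx := by
    refine ⟨DyadicInterval.around n x hx, ⟨?_, DyadicInterval.mem_around n x hx⟩, ?_⟩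
    · exact Finset.mem_image.2 ⟨⟨_, (DyadicInterval.around n x hx).idx_lt⟩, Finset.mem_univ _, rfl⟩
    · rintro i ⟨hi, hxi⟩
      obtain ⟨p, -, rfl⟩ := Finset.mem_image.1 hi
      exact DyadicInterval.eq_of_mem hxi (DyadicInterval.mem_around n x hx) rfl

lemma mem_uniform {n : ℕ} {i : DyadicInterval} : i ∈ (uniform n).parts ↔ i.level = n := by
  constructor
  · intro h
    obtain ⟨p, -, rfl⟩ := Finset.mem_image.1 h
    rfl
  · rintro rfl
    exact Finset.mem_image.2 ⟨⟨_, i.idx_lt⟩, Finset.mem_univ _, rfl⟩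

lemma le_uniform {I : DyadicPartition} {n : ℕ} (h : ∀ i ∈ I.parts, i.level ≤ n) :
    I ≤ uniform n := by
  refine le_iff.2 fun j hj => ?_
  obtain ⟨i, ⟨hi, hx⟩, -⟩ := I.existsUnique_mem _ (j.toSet_subset j.left_mem)
  exact ⟨i, hi, DyadicInterval.subset_of_mem hx j.left_mem ((h i hi).trans (mem_uniform.1 hj).ge)⟩

/-- The depth of the tree of a finite set of intervals. -/
def depth (J : Finset DyadicInterval) : ℕ := J.sup DyadicInterval.level

lemma level_le_depth {J : Finset DyadicInterval} {i : DyadicInterval} (h : i ∈ J) :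
    i.level ≤ depth J := Finset.le_sup (f := DyadicInterval.level) h

instance : Nonempty DyadicPartition := ⟨uniform 0⟩

instance : IsDirectedOrder DyadicPartition where
  directed I J := ⟨uniform (max (depth I.parts) (depth J.parts)),
    le_uniform fun _ hi => (level_le_depth hi).trans (le_max_left _ _),
    le_uniform fun _ hi => (level_le_depth hi).trans (le_max_right _ _)⟩

/-- The intervals that correspond to the nodes of the tree of `J`. -/
inductive Sub (J : Finset DyadicInterval) : DyadicInterval → Prop
  | mem {i : DyadicInterval} : i ∈ J → Sub J i
  | split {i : DyadicInterval} : i ∉ J → i.level < depth J → Sub J i.fst → Sub J i.snd → Sub J i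

lemma sub_of_subset (J : DyadicPartition) {i j : DyadicInterval} (hj : j ∈ J.parts)
    (h : j.toSet ⊆ i.toSet) : Sub J.parts i := by
  obtain ⟨n, hn⟩ : ∃ n, n = depth J.parts - i.level := ⟨_, rfl⟩
  induction n generalizing i j with
  | zero =>
    have h1 := level_le_depth hj
    have h2 := DyadicInterval.level_le_of_subset h
    exact .mem (DyadicInterval.eq_of_mem (h j.left_mem) j.left_mem (by omega) ▸ hj)
  | succ n ih =>
    by_cases hi : i ∈ J.parts
    · exact .mem hi
    have key : ∀ i' : DyadicInterval, i'.level = i.level + 1 → i'.toSet ⊆ i.toSet →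
        Sub J.parts i' := by
      intro i' hl hs
      obtain ⟨j', ⟨hj', hx⟩, -⟩ := J.existsUnique_mem _ (i'.toSet_subset i'.left_mem)
      refine ih hj' (DyadicInterval.subset_of_mem i'.left_mem hx ?_) (by omega)
      by_contra hlt
      have h1 := DyadicInterval.subset_of_mem hx (hs i'.left_mem) (by omega)
      have h2 := J.eq_of_mem hj hj' j.left_mem (h1 (h j.left_mem))
      subst h2
      exact hi (DyadicInterval.eq_of_subset h h1 ▸ hj)
    have hne : j ≠ i := fun he => hi (he ▸ hj)
    exact .split hi ((DyadicInterval.subset_half h hne).1.trans_le (level_le_depth hj))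
      (key _ rfl i.fst_subset) (key _ rfl i.snd_subset)

lemma Sub.exists {J : Finset DyadicInterval} {i : DyadicInterval} (h : Sub J i) :
    ∃ j ∈ J, j.toSet ⊆ i.toSet := by
  induction h with
  | mem h => exact ⟨_, h, Subset.rfl⟩
  | split _ _ _ _ ih _ =>
    obtain ⟨j, hj, h⟩ := ih
    exact ⟨j, hj, h.trans (DyadicInterval.fst_subset _)⟩

lemma sub_of_le {I J : DyadicPartition} (h : I ≤ J) {i : DyadicInterval} (hi : i ∈ I.parts) :
    Sub J.parts i := by
  obtain ⟨j, ⟨hj, hx⟩, -⟩ := J.existsUnique_mem _ (i.toSet_subset i.left_mem)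
  obtain ⟨i', hi', hs⟩ := le_iff.1 h j hj
  rw [← I.eq_of_mem hi hi' i.left_mem (hs hx)] at hs
  exact J.sub_of_subset hj hs

/-- `Merge J S` says that the finite set `S` arises from `J` by successively merging two halves
of a dyadic interval. -/
inductive Merge (J : Finset DyadicInterval) : Finset DyadicInterval → Prop
  | refl : Merge J J
  | merge {S : Finset DyadicInterval} {i : DyadicInterval} : i ∉ J → i.level < depth J →
      i ∉ S → i.fst ∉ S → i.snd ∉ S → Merge J (insert i.fst (insert i.snd S)) →
      Merge J (insert i S)

/-- Split one interval of a partition. -/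
def splitAt (I : DyadicPartition) (i : DyadicInterval) (hi : i ∈ I.parts) : DyadicPartition where
  parts := insert i.fst (insert i.snd (I.parts.erase i))
  existsUnique_mem x hx := by
    obtain ⟨j, ⟨hj, hxj⟩, huj⟩ := I.existsUnique_mem x hx
    by_cases hji : j = i
    · subst hji
      have hno : ∀ l ∈ I.parts.erase j, x ∉ l.toSet := fun l hl hxl =>
        (Finset.mem_erase.1 hl).1 (huj l ⟨(Finset.mem_erase.1 hl).2, hxl⟩)
      rcases DyadicInterval.mem_fst_or_snd.1 hxj with h | h
      · refine ⟨j.fst, ⟨by simp, h⟩, ?_⟩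
        rintro l ⟨hl, hxl⟩
        rcases Finset.mem_insert.1 hl with rfl | hl
        · rfl
        rcases Finset.mem_insert.1 hl with rfl | hl
        · exact (DyadicInterval.not_mem_fst_snd h hxl).elim
        · exact (hno l hl hxl).elim
      · refine ⟨j.snd, ⟨by simp, h⟩, ?_⟩
        rintro l ⟨hl, hxl⟩
        rcases Finset.mem_insert.1 hl with rfl | hl
        · exact (DyadicInterval.not_mem_fst_snd hxl h).elim
        rcases Finset.mem_insert.1 hl with rfl | hl
        · rfl
        · exact (hno l hl hxl).elim
    · have hxi : x ∉ i.toSet := fun h => hji (huj i ⟨hi, h⟩).symm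
      refine ⟨j, ⟨?_, hxj⟩, ?_⟩
      · exact Finset.mem_insert_of_mem (Finset.mem_insert_of_mem (Finset.mem_erase.2 ⟨hji, hj⟩))
      · rintro l ⟨hl, hxl⟩
        rcases Finset.mem_insert.1 hl with rfl | hl
        · exact (hxi (i.fst_subset hxl)).elim
        rcases Finset.mem_insert.1 hl with rfl | hl
        · exact (hxi (i.snd_subset hxl)).elim
        · exact huj l ⟨(Finset.mem_erase.1 hl).2, hxl⟩

lemma merge_of_le {I J : DyadicPartition} (h : I ≤ J) : Merge J.parts I.parts := by
  obtain ⟨n, hn⟩ : ∃ n, ∑ i ∈ I.parts, 3 ^ (depth J.parts - i.level) = n := ⟨_, rfl⟩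
  induction n using Nat.strong_induction_on generalizing I with
  | _ n ih =>
  by_cases hsub : I.parts ⊆ J.parts
  · rw [ext_of_subset hsub]; exact .refl
  · obtain ⟨i, hi, hiJ⟩ := Finset.not_subset.1 hsub
    have hlt : i.level < depth J.parts := by
      cases sub_of_le h hi with
      | mem h => exact (hiJ h).elim
      | split _ h _ _ => exact h
    have hnot : ∀ l : DyadicInterval, l.toSet ⊆ i.toSet → l.level = i.level + 1 →
        l ∉ I.parts.erase i := fun l hl hlev hmem => by
      have := I.eq_of_mem hi (Finset.mem_erase.1 hmem).2 (hl l.left_mem) l.left_mem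
      rw [← this] at hlev
      omega
    have h1 := hnot _ i.fst_subset rfl
    have h2 := hnot _ i.snd_subset rfl
    have hle : I.splitAt i hi ≤ J := by
      refine le_iff.2 fun j hj => ?_
      obtain ⟨i', hi', hs⟩ := le_iff.1 h j hj
      by_cases he : i' = i
      · subst he
        have hne : j ≠ i' := fun he => hiJ (he ▸ hj)
        rcases (DyadicInterval.subset_half hs hne).2 with hs | hs
        · exact ⟨_, by simp [splitAt], hs⟩
        · exact ⟨i'.snd, by simp [splitAt], hs⟩
      · exact ⟨i', by simp [splitAt, he, hi'], hs⟩
    have := ih _ ?_ hle rfl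
    · rw [← Finset.insert_erase hi]
      exact .merge hiJ hlt (Finset.notMem_erase _ _) h1 h2 this
    · rw [← hn]
      have hfs : i.fst ∉ insert i.snd (I.parts.erase i) := by
        simp only [Finset.mem_insert, not_or]; exact ⟨i.fst_ne_snd, h1⟩
      simp only [splitAt]
      rw [Finset.sum_insert hfs, Finset.sum_insert h2, ← Finset.add_sum_erase _ _ hi]
      obtain ⟨m, hm⟩ : ∃ m, depth J.parts - i.level = m + 1 := ⟨depth J.parts - i.level - 1, by omega⟩
      have e1 : depth J.parts - i.fst.level = m := by simp only [DyadicInterval.fst]; omega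
      have e2 : depth J.parts - i.snd.level = m := by simp only [DyadicInterval.snd]; omega
      rw [hm, e1, e2, pow_succ]
      have : 0 < 3 ^ m := by positivity
      omega

end DyadicPartition

/-! ### Tree tensor networks -/

/-- The isometries `V : ℂ^d → ℂ^d ⊗ ℂ^d`, as matrices with respect to the standard bases:
`V (p, q) k` is the coefficient of `e_p ⊗ e_q` in `V e_k`, and `V† V = 1`. -/
abbrev SpinIsometry (d : ℕ) : Type :=
  {V : Matrix (Fin d × Fin d) (Fin d) ℂ // V.conjTranspose * V = 1}

/-- The Hilbert space `(ℂ^d)^{⊗ I}` with one spin `ℂ^d` for each interval of `I`, realised by the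
coefficients with respect to the product basis: `a : I → {1, …, d}` stands for `⨂ i, e_{a i}`. -/
abbrev SpinSpace (d : ℕ) (I : DyadicPartition) : Type :=
  EuclideanSpace ℂ (I.parts → Fin d)

variable {d : ℕ}

/-- Contract the tree tensor network with root `i`, whose leaves are the intervals of `J` inside `i`
and which has a copy of `V` at each inner node: leaf `j` is contracted with the
covector `w j`, and the result is a covector on the root leg. -/
def contract (V : SpinIsometry d) (J : Finset DyadicInterval) (w : DyadicInterval → Fin d → ℂ)
    (i : DyadicInterval) : Fin d → ℂ :=
  if i ∈ J then w i
  else if _h : i.level < DyadicPartition.depth J then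
    fun k => ∑ pq : Fin d × Fin d,
      V.1 pq k * (contract V J w i.fst pq.1 * contract V J w i.snd pq.2)
  else 0
termination_by DyadicPartition.depth J - i.level
decreasing_by all_goals (simp only [DyadicInterval.fst, DyadicInterval.snd]; omega)

/-- The dual basis covectors that belong to a configuration `c`. -/
def leafCovector {J : Finset DyadicInterval} (c : J → Fin d) (j : DyadicInterval) (k : Fin d) : ℂ :=
  if h : j ∈ J then if c ⟨j, h⟩ = k then 1 else 0 else 0

/-- The matrix entries of the refining map from `(ℂ^d)^{⊗ I}` to `(ℂ^d)^{⊗ J}`: the forest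
consists of one tree for each interval of `I`. -/
def refineEntry (V : SpinIsometry d) (I J : DyadicPartition) (c : J.parts → Fin d)
    (a : I.parts → Fin d) : ℂ :=
  ∏ i : I.parts, contract V J.parts (leafCovector c) i (a i)

/-- The refining map `ι_{J, I}` from `(ℂ^d)^{⊗ I}` to `(ℂ^d)^{⊗ J}` (for `I ≤ J`), as a linear
map. -/
def refineLin (V : SpinIsometry d) (I J : DyadicPartition) :
    SpinSpace d I →ₗ[ℂ] SpinSpace d J :=
  Matrix.toEuclideanLin (Matrix.of fun c a => refineEntry V I J c a)

lemma contract_mem (V : SpinIsometry d) {J : Finset DyadicInterval}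
    (w : DyadicInterval → Fin d → ℂ) {i : DyadicInterval} (h : i ∈ J) :
    contract V J w i = w i := by
  rw [contract, if_pos h]

lemma contract_split (V : SpinIsometry d) {J : Finset DyadicInterval}
    (w : DyadicInterval → Fin d → ℂ) {i : DyadicInterval} (h : i ∉ J)
    (hl : i.level < DyadicPartition.depth J) (k : Fin d) :
    contract V J w i k = ∑ pq : Fin d × Fin d,
      V.1 pq k * (contract V J w i.fst pq.1 * contract V J w i.snd pq.2) := by
  rw [contract, if_neg h, dif_pos hl]

lemma prod_parts {I : Finset DyadicInterval} (g : DyadicInterval → Fin d → ℂ)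
    (a : I → Fin d) (a' : DyadicInterval → Fin d) (h : ∀ i : I, a i = a' i) :
    ∏ i : I, g i (a i) = ∏ i ∈ I, g i (a' i) := by
  rw [← Finset.prod_coe_sort I]
  exact Finset.prod_congr rfl fun i _ => by rw [h]

/-- Relabel the two halves of `i`. -/
def upd (a : DyadicInterval → Fin d) (i : DyadicInterval) (pq : Fin d × Fin d) :
    DyadicInterval → Fin d :=
  Function.update (Function.update a i.snd pq.2) i.fst pq.1

lemma prod_upd (g : DyadicInterval → Fin d → ℂ) (a : DyadicInterval → Fin d)
    {S : Finset DyadicInterval} {i : DyadicInterval} (h1 : i.fst ∉ S) (h2 : i.snd ∉ S)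
    (pq : Fin d × Fin d) :
    ∏ j ∈ insert i.fst (insert i.snd S), g j (upd a i pq j) =
      g i.fst pq.1 * g i.snd pq.2 * ∏ j ∈ S, g j (a j) := by
  have hfs : i.fst ∉ insert i.snd S := by
    simp only [Finset.mem_insert, not_or]; exact ⟨i.fst_ne_snd, h1⟩
  rw [Finset.prod_insert hfs, Finset.prod_insert h2, mul_assoc]
  congr 1
  · simp [upd]
  congr 1
  · simp [upd, Function.update_of_ne i.fst_ne_snd.symm]
  · refine Finset.prod_congr rfl fun j hj => ?_
    have e1 : j ≠ i.fst := fun h => h1 (h ▸ hj)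
    have e2 : j ≠ i.snd := fun h => h2 (h ▸ hj)
    simp [upd, Function.update_of_ne e1, Function.update_of_ne e2]

lemma prod_contract_insert (V : SpinIsometry d) {J : Finset DyadicInterval}
    (w : DyadicInterval → Fin d → ℂ) (a : DyadicInterval → Fin d)
    {S : Finset DyadicInterval} {i : DyadicInterval} (hi : i ∉ J)
    (hl : i.level < DyadicPartition.depth J) (h0 : i ∉ S) (h1 : i.fst ∉ S) (h2 : i.snd ∉ S) :
    ∏ j ∈ insert i S, contract V J w j (a j) =
      ∑ pq : Fin d × Fin d, V.1 pq (a i) *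
        ∏ j ∈ insert i.fst (insert i.snd S), contract V J w j (upd a i pq j) := by
  rw [Finset.prod_insert h0, contract_split V w hi hl, Finset.sum_mul]
  refine Finset.sum_congr rfl fun pq _ => ?_
  rw [prod_upd (fun j => contract V J w j) a h1 h2]
  ring

lemma sum_contract (V : SpinIsometry d) {J : Finset DyadicInterval}
    (w : DyadicInterval → Fin d → ℂ) {S : Finset DyadicInterval}
    (h : DyadicPartition.Merge J S) (a : DyadicInterval → Fin d) :
    ∑ c : J → Fin d, (∏ j : J, w j (c j)) *
      ∏ i ∈ S, contract V J (leafCovector c) i (a i) = ∏ i ∈ S, contract V J w i (a i) := by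
  induction h generalizing a with
  | refl =>
    rw [Finset.sum_eq_single (fun j : J => a j)]
    · have e : ∏ i ∈ J, contract V J (leafCovector fun j : J => a j) i (a i) = 1 := by
        refine Finset.prod_eq_one fun j hj => ?_
        rw [contract_mem V _ hj]
        simp [leafCovector, hj]
      rw [e, mul_one, Finset.prod_coe_sort J (fun j => w j (a j))]
      exact Finset.prod_congr rfl fun j hj => by rw [contract_mem V w hj]
    · intro c _ hc
      obtain ⟨j, hj⟩ := Function.ne_iff.1 hc
      refine mul_eq_zero_of_right _ (Finset.prod_eq_zero j.2 ?_)
      rw [contract_mem V _ j.2]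
      simp [leafCovector, hj]
    · simp
  | @merge S i hi hl h0 h1 h2 _ ih =>
    simp_rw [prod_contract_insert V _ a hi hl h0 h1 h2, ← ih, Finset.mul_sum]
    rw [Finset.sum_comm]
    exact Finset.sum_congr rfl fun _ _ => Finset.sum_congr rfl fun _ _ => by ring

lemma isometry_entry (V : SpinIsometry d) (k l : Fin d) :
    ∑ pq : Fin d × Fin d, star (V.1 pq k) * V.1 pq l = if k = l then 1 else 0 := by
  have := congrFun (congrFun V.2 k) l
  simpa [Matrix.mul_apply, Matrix.one_apply] using this

lemma sum_contract_star (V : SpinIsometry d) {J : Finset DyadicInterval}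
    {S : Finset DyadicInterval} (h : DyadicPartition.Merge J S) (a b : DyadicInterval → Fin d) :
    ∑ c : J → Fin d, star (∏ i ∈ S, contract V J (leafCovector c) i (a i)) *
      ∏ i ∈ S, contract V J (leafCovector c) i (b i) =
        ∏ i ∈ S, if a i = b i then (1 : ℂ) else 0 := by
  induction h generalizing a b with
  | refl =>
    rw [Finset.sum_eq_single (fun j : J => a j)]
    · rw [Finset.prod_eq_one, star_one, one_mul]
      · refine Finset.prod_congr rfl fun j hj => ?_
        rw [contract_mem V _ hj]
        simp [leafCovector, hj]
      · intro j hj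
        rw [contract_mem V _ hj]
        simp [leafCovector, hj]
    · intro c _ hc
      obtain ⟨j, hj⟩ := Function.ne_iff.1 hc
      refine mul_eq_zero_of_left ?_ _
      rw [star_eq_zero]
      refine Finset.prod_eq_zero j.2 ?_
      rw [contract_mem V _ j.2]
      simp [leafCovector, hj]
    · simp
  | @merge S i hi hl h0 h1 h2 _ ih =>
    simp_rw [prod_contract_insert V _ _ hi hl h0 h1 h2, star_sum, Finset.sum_mul_sum]
    rw [Finset.sum_comm]
    simp_rw [Finset.sum_comm (s := (Finset.univ : Finset (J → Fin d)))]
    have : ∀ pq rs : Fin d × Fin d, (∑ c : J → Fin d,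
        star (V.1 pq (a i) * ∏ j ∈ insert i.fst (insert i.snd S),
          contract V J (leafCovector c) j (upd a i pq j)) *
        (V.1 rs (b i) * ∏ j ∈ insert i.fst (insert i.snd S),
          contract V J (leafCovector c) j (upd b i rs j))) =
        if pq = rs then star (V.1 pq (a i)) * V.1 rs (b i) *
          ∏ j ∈ S, (if a j = b j then (1 : ℂ) else 0) else 0 := by
      intro pq rs
      have e : ∀ x y z t : ℂ, star (x * y) * (z * t) = (star x * z) * (star y * t) := by
        intro x y z t; rw [star_mul']; ring
      simp_rw [e, ← Finset.mul_sum]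
      rw [ih]
      have hS : ∏ j ∈ S, (if upd a i pq j = upd b i rs j then (1 : ℂ) else 0) =
          ∏ j ∈ S, (if a j = b j then (1 : ℂ) else 0) := by
        refine Finset.prod_congr rfl fun j hj => ?_
        have e1 : j ≠ i.fst := fun h => h1 (h ▸ hj)
        have e2 : j ≠ i.snd := fun h => h2 (h ▸ hj)
        simp [upd, Function.update_of_ne e1, Function.update_of_ne e2]
      have hfs : i.fst ∉ insert i.snd S := by
        simp only [Finset.mem_insert, not_or]; exact ⟨i.fst_ne_snd, h1⟩
      rw [Finset.prod_insert hfs, Finset.prod_insert h2, hS]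
      simp only [upd, Function.update_self, Function.update_of_ne i.fst_ne_snd.symm]
      by_cases hp : pq.1 = rs.1 <;> by_cases hq : pq.2 = rs.2 <;> simp [hp, hq, Prod.ext_iff]
    simp_rw [this]
    simp only [Finset.sum_ite_eq, Finset.mem_univ, if_true]
    rw [← Finset.sum_mul, isometry_entry, Finset.prod_insert h0]

lemma contract_trans (V : SpinIsometry d) {J K : DyadicPartition} (h : J ≤ K)
    (w : DyadicInterval → Fin d → ℂ) {i : DyadicInterval} (hi : DyadicPartition.Sub J.parts i) :
    contract V J.parts (contract V K.parts w) i = contract V K.parts w i := by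
  induction hi with
  | mem h => rw [contract_mem V _ h]
  | @split i h1 h2 h3 h4 ih1 ih2 =>
    have hK : DyadicPartition.Sub K.parts i := by
      obtain ⟨j, hj, hs⟩ := (DyadicPartition.Sub.split h1 h2 h3 h4).exists
      obtain ⟨k, ⟨hk, hx⟩, -⟩ := K.existsUnique_mem _ (j.toSet_subset j.left_mem)
      obtain ⟨j', hj', hs'⟩ := DyadicPartition.le_iff.1 h k hk
      rw [← J.eq_of_mem hj hj' j.left_mem (hs' hx)] at hs'
      exact K.sub_of_subset hk (hs'.trans hs)
    funext k
    cases hK with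
    | mem hK =>
      exfalso
      obtain ⟨j', hj', hs'⟩ := DyadicPartition.le_iff.1 h _ hK
      obtain ⟨j, hj, hs⟩ := (DyadicPartition.Sub.split h1 h2 h3 h4).exists
      have := J.eq_of_mem hj hj' j.left_mem (hs' (hs j.left_mem))
      subst this
      exact h1 (DyadicInterval.eq_of_subset hs hs' ▸ hj)
    | split h1' h2' _ _ =>
      rw [contract_split V _ h1 h2, contract_split V _ h1' h2', ih1, ih2]

lemma exists_extend {I : DyadicPartition} (a : I.parts → Fin d) :
    ∃ a' : DyadicInterval → Fin d, ∀ i : I.parts, a i = a' i := by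
  obtain ⟨i, ⟨hi, -⟩, -⟩ := I.existsUnique_mem 0 ⟨le_rfl, one_pos⟩
  exact ⟨fun j => if h : j ∈ I.parts then a ⟨j, h⟩ else a ⟨i, hi⟩, fun j => by simp⟩

lemma refineLin_apply (V : SpinIsometry d) (I J : DyadicPartition) (x : SpinSpace d I)
    (c : J.parts → Fin d) :
    refineLin V I J x c = ∑ a : I.parts → Fin d, refineEntry V I J c a * x a := by
  simp [refineLin, Matrix.toEuclideanLin, Matrix.mulVec, dotProduct]

lemma refineLin_self (V : SpinIsometry d) (I : DyadicPartition) (x : SpinSpace d I) :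
    refineLin V I I x = x := by
  ext c
  rw [refineLin_apply, Finset.sum_eq_single c]
  · rw [refineEntry, Finset.prod_eq_one, one_mul]
    intro i _
    rw [contract_mem V _ i.2]
    simp [leafCovector]
  · intro a _ hac
    obtain ⟨j, hj⟩ := Function.ne_iff.1 hac
    refine mul_eq_zero_of_left (Finset.prod_eq_zero (Finset.mem_univ j) ?_) _
    rw [contract_mem V _ j.2]
    simp [leafCovector, Ne.symm hj]
  · simp

lemma refineEntry_eq (V : SpinIsometry d) {I J : DyadicPartition} {a : I.parts → Fin d}
    {a' : DyadicInterval → Fin d} (h : ∀ i : I.parts, a i = a' i) (c : J.parts → Fin d) :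
    refineEntry V I J c a = ∏ i ∈ I.parts, contract V J.parts (leafCovector c) i (a' i) :=
  prod_parts (fun i => contract V J.parts (leafCovector c) i) a a' h

lemma refineEntry_trans (V : SpinIsometry d) {I J K : DyadicPartition} (hIJ : I ≤ J) (hJK : J ≤ K)
    (c : K.parts → Fin d) (a : I.parts → Fin d) :
    ∑ b : J.parts → Fin d, refineEntry V J K c b * refineEntry V I J b a =
      refineEntry V I K c a := by
  obtain ⟨a', ha'⟩ := exists_extend a
  simp_rw [refineEntry_eq V ha']
  have := sum_contract V (contract V K.parts (leafCovector c)) (DyadicPartition.merge_of_le hIJ) a'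
  refine Eq.trans this ?_
  exact Finset.prod_congr rfl fun i hi => by
    rw [contract_trans V hJK _ (DyadicPartition.sub_of_le hIJ hi)]

lemma refineLin_trans (V : SpinIsometry d) {I J K : DyadicPartition} (hIJ : I ≤ J) (hJK : J ≤ K)
    (x : SpinSpace d I) : refineLin V J K (refineLin V I J x) = refineLin V I K x := by
  ext c
  simp_rw [refineLin_apply, Finset.mul_sum]
  rw [Finset.sum_comm]
  refine Finset.sum_congr rfl fun a _ => ?_
  rw [← refineEntry_trans V hIJ hJK, Finset.sum_mul]
  exact Finset.sum_congr rfl fun b _ => by ring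

lemma refineEntry_star (V : SpinIsometry d) {I J : DyadicPartition} (h : I ≤ J)
    (a b : I.parts → Fin d) :
    ∑ c : J.parts → Fin d, star (refineEntry V I J c a) * refineEntry V I J c b =
      if a = b then 1 else 0 := by
  obtain ⟨a', ha'⟩ := exists_extend a
  obtain ⟨b', hb'⟩ := exists_extend b
  simp_rw [refineEntry_eq V ha', refineEntry_eq V hb']
  rw [sum_contract_star V (DyadicPartition.merge_of_le h)]
  split_ifs with hab
  · refine Finset.prod_eq_one fun i hi => if_pos ?_
    rw [← ha' ⟨i, hi⟩, ← hb' ⟨i, hi⟩, hab]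
  · obtain ⟨j, hj⟩ := Function.ne_iff.1 hab
    refine Finset.prod_eq_zero j.2 (if_neg ?_)
    rw [← ha' j, ← hb' j]
    exact hj

lemma refineLin_inner (V : SpinIsometry d) {I J : DyadicPartition} (h : I ≤ J)
    (x y : SpinSpace d I) :
    inner ℂ (refineLin V I J x) (refineLin V I J y) = inner ℂ x y := by
  simp only [PiLp.inner_apply, RCLike.inner_apply, refineLin_apply, map_sum, map_mul,
    Finset.sum_mul_sum]
  rw [Finset.sum_comm]
  simp_rw [Finset.sum_comm (s := (Finset.univ : Finset (J.parts → Fin d)))]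
  have : ∀ b a : I.parts → Fin d, (∑ c : J.parts → Fin d, refineEntry V I J c b * y b *
      ((starRingEnd ℂ) (refineEntry V I J c a) * (starRingEnd ℂ) (x a))) =
      if a = b then y b * (starRingEnd ℂ) (x a) else 0 := by
    intro b a
    have := refineEntry_star V h a b
    calc _ = (∑ c : J.parts → Fin d, star (refineEntry V I J c a) * refineEntry V I J c b) *
          (y b * (starRingEnd ℂ) (x a)) := by
            rw [Finset.sum_mul]
            exact Finset.sum_congr rfl fun c _ => by rw [starRingEnd_apply]; ring
      _ = _ := by rw [this]; split_ifs <;> simp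
  simp_rw [this]
  simp

/-- The refining map `ι_{J, I}`, an isometry. -/
def refine (V : SpinIsometry d) (I J : DyadicPartition) (h : I ≤ J) :
    SpinSpace d I →ₗᵢ[ℂ] SpinSpace d J :=
  (refineLin V I J).isometryOfInner (refineLin_inner V h)

lemma refine_apply (V : SpinIsometry d) {I J : DyadicPartition} (h : I ≤ J) (x : SpinSpace d I) :
    refine V I J h x = refineLin V I J x := rfl

instance (V : SpinIsometry d) :
    DirectedSystem (SpinSpace d) (fun I J h => refine V I J h) where
  map_self I x := refineLin_self V I x
  map_map _ _ _ hIJ hJK x := refineLin_trans V hIJ hJK x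

/-! ### The semicontinuous limit -/

/-- The disjoint union of the spaces `(ℂ^d)^{⊗ I}` modulo the relation that identifies two vectors
whose refinements to some common refinement agree. -/
def PreLimit (V : SpinIsometry d) : Type :=
  DirectLimit (SpinSpace d) (fun I J h => refine V I J h)

instance (V : SpinIsometry d) : AddCommGroup (PreLimit V) :=
  inferInstanceAs (AddCommGroup (DirectLimit (SpinSpace d) (fun I J h => refine V I J h)))

instance (V : SpinIsometry d) : Module ℂ (PreLimit V) :=
  inferInstanceAs (Module ℂ (DirectLimit (SpinSpace d) (fun I J h => refine V I J h)))

/-- The equivalence class of a vector. -/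
def PreLimit.mk (V : SpinIsometry d) (I : DyadicPartition) (x : SpinSpace d I) : PreLimit V :=
  (⟦⟨I, x⟩⟧ : DirectLimit (SpinSpace d) (fun I J h => refine V I J h))

namespace PreLimit

lemma mk_add (V : SpinIsometry d) (I : DyadicPartition) (x y : SpinSpace d I) :
    mk V I x + mk V I y = mk V I (x + y) :=
  DirectLimit.add_def (f := fun I J h => refine V I J h) I x y

lemma mk_smul (V : SpinIsometry d) (I : DyadicPartition) (r : ℂ) (x : SpinSpace d I) :
    r • mk V I x = mk V I (r • x) :=
  DirectLimit.smul_def (f := fun I J h => refine V I J h) I x r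

lemma mk_zero (V : SpinIsometry d) (I : DyadicPartition) : mk V I 0 = 0 :=
  (DirectLimit.zero_def (f := fun I J h => refine V I J h) I).symm

lemma mk_refine (V : SpinIsometry d) {I J : DyadicPartition} (h : I ≤ J) (x : SpinSpace d I) :
    mk V J (refineLin V I J x) = mk V I x :=
  DirectLimit.mk_apply (f := fun I J h => refine V I J h) I J x h

lemma ind {V : SpinIsometry d} {C : PreLimit V → Prop} (h : ∀ I x, C (mk V I x)) (z) : C z :=
  DirectLimit.induction (fun I J h => refine V I J h) h z

lemma ind₂ {V : SpinIsometry d} {C : PreLimit V → PreLimit V → Prop}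
    (h : ∀ I x y, C (mk V I x) (mk V I y)) (z w) : C z w :=
  DirectLimit.induction₂ (fun I J h => refine V I J h) h z w

lemma ind₃ {V : SpinIsometry d} {C : PreLimit V → PreLimit V → PreLimit V → Prop}
    (h : ∀ I x y z, C (mk V I x) (mk V I y) (mk V I z)) (x y z) : C x y z :=
  DirectLimit.induction₃ (fun I J h => refine V I J h) h x y z

/-- The inner product of two classes, computed after refining to a common partition. -/
def innerFun (V : SpinIsometry d) (z w : PreLimit V) : ℂ :=
  DirectLimit.lift₂ (fun I J h => refine V I J h) (fun I J h => refine V I J h)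
    (fun _ x y => inner ℂ x y)
    (fun I J h x y => ((refine V I J h).inner_map_map x y).symm) z w

lemma innerFun_mk (V : SpinIsometry d) (I : DyadicPartition) (x y : SpinSpace d I) :
    innerFun V (mk V I x) (mk V I y) = inner ℂ x y :=
  DirectLimit.lift₂_def (fun I J h => refine V I J h) (fun I J h => refine V I J h) _ _ I x y

/-- The inner product on the classes. -/
@[reducible] def core (V : SpinIsometry d) : InnerProductSpace.Core ℂ (PreLimit V) where
  inner := innerFun V
  conj_inner_symm := ind₂ fun I x y => by
    rw [innerFun_mk, innerFun_mk]; exact inner_conj_symm x y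
  re_inner_nonneg := ind fun I x => by
    rw [innerFun_mk]; exact inner_self_nonneg
  add_left := ind₃ fun I x y z => by
    rw [mk_add, innerFun_mk, innerFun_mk, innerFun_mk]; exact inner_add_left x y z
  smul_left z w r := by
    induction z, w using ind₂ with
    | h I x y => rw [mk_smul, innerFun_mk, innerFun_mk]; exact inner_smul_left x y r
  definite := ind fun I x h => by
    rw [innerFun_mk, inner_self_eq_zero] at h
    rw [h, mk_zero]

instance (V : SpinIsometry d) : NormedAddCommGroup (PreLimit V) :=
  (core V).toNormedAddCommGroup

instance (V : SpinIsometry d) : InnerProductSpace ℂ (PreLimit V) :=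
  InnerProductSpace.ofCore (core V).toCore

lemma inner_mk (V : SpinIsometry d) (I : DyadicPartition) (x y : SpinSpace d I) :
    inner ℂ (mk V I x) (mk V I y) = inner ℂ x y := innerFun_mk V I x y

end PreLimit

/-- The semicontinuous limit Hilbert space. -/
abbrev SemicontinuousLimit (V : SpinIsometry d) : Type :=
  UniformSpace.Completion (PreLimit V)

/-! ### The Thompson group `T` -/

/-- The dyadic rational points of the circle `ℝ / ℤ`. -/
def IsDyadic (x : UnitAddCircle) : Prop :=
  ∃ (p : ℤ) (n : ℕ), x = ((p / 2 ^ n : ℝ) : UnitAddCircle)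

/-- Near `x`, the map `f` is affine with slope `2 ^ k`. -/
def HasSlopeAt (f : UnitAddCircle → UnitAddCircle) (k : ℤ) (x : UnitAddCircle) : Prop :=
  ∀ᶠ h : ℝ in 𝓝 0, f (x + (h : UnitAddCircle)) = f x + (((2 : ℝ) ^ k * h : ℝ) : UnitAddCircle)

lemma isDyadic_sub {x y : UnitAddCircle} (hx : IsDyadic x) (hy : IsDyadic y) :
    IsDyadic (x - y) := by
  obtain ⟨p, n, rfl⟩ := hx
  obtain ⟨q, m, rfl⟩ := hy
  refine ⟨p * 2 ^ m - q * 2 ^ n, n + m, ?_⟩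
  rw [← AddCircle.coe_sub]
  congr 1
  push_cast
  field_simp
  ring

lemma isDyadic_zpow (k : ℤ) (p : ℤ) (n : ℕ) :
    IsDyadic (((2 : ℝ) ^ k * (p / 2 ^ n) : ℝ) : UnitAddCircle) := by
  obtain ⟨m, rfl | rfl⟩ := Int.eq_nat_or_neg k
  · exact ⟨2 ^ m * p, n, by congr 1; push_cast; rw [zpow_natCast]; ring⟩
  · exact ⟨p, n + m, by congr 1; rw [zpow_neg, zpow_natCast, pow_add]; field_simp⟩

lemma exists_dyadic {s : Set ℝ} {x : ℝ} (hs : s ∈ 𝓝 x) :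
    ∃ (p : ℤ) (n : ℕ), (p / 2 ^ n : ℝ) ∈ s := by
  obtain ⟨ε, hε, h⟩ := Metric.mem_nhds_iff.1 hs
  obtain ⟨n, hn⟩ := exists_pow_lt_of_lt_one hε (by norm_num : (1 / 2 : ℝ) < 1)
  refine ⟨⌊x * 2 ^ n⌋, n, h ?_⟩
  have h0 : (0 : ℝ) < 2 ^ n := by positivity
  have h1 := Int.floor_le (x * 2 ^ n)
  have h2 := Int.lt_floor_add_one (x * 2 ^ n)
  rw [one_div_pow] at hn
  rw [Metric.mem_ball, Real.dist_eq, abs_lt]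
  constructor
  · have : x < (⌊x * 2 ^ n⌋ : ℝ) / 2 ^ n + 1 / 2 ^ n := by
      rw [← add_div, lt_div_iff₀ h0]; exact h2
    linarith
  · have : (⌊x * 2 ^ n⌋ : ℝ) / 2 ^ n ≤ x := by
      rw [div_le_iff₀ h0]; exact h1
    linarith

lemma HasSlopeAt.symm {f : UnitAddCircle ≃ₜ UnitAddCircle} {k : ℤ} {x : UnitAddCircle}
    (h : HasSlopeAt f k x) : HasSlopeAt f.symm (-k) (f x) := by
  have ht : Tendsto (fun h : ℝ => (2 : ℝ) ^ (-k) * h) (𝓝 0) (𝓝 0) := by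
    have : Continuous fun h : ℝ => (2 : ℝ) ^ (-k) * h := by fun_prop
    simpa using this.tendsto 0
  filter_upwards [ht.eventually h] with u hu
  rw [← mul_assoc, ← zpow_add₀ (by norm_num), add_neg_cancel, zpow_zero, one_mul] at hu
  rw [← hu, f.symm_apply_apply, f.symm_apply_apply]

lemma HasSlopeAt.comp {f g : UnitAddCircle → UnitAddCircle} {k l : ℤ} {x : UnitAddCircle}
    (hf : HasSlopeAt f k (g x)) (hg : HasSlopeAt g l x) : HasSlopeAt (f ∘ g) (k + l) x := by
  have ht : Tendsto (fun h : ℝ => (2 : ℝ) ^ l * h) (𝓝 0) (𝓝 0) := by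
    have : Continuous fun h : ℝ => (2 : ℝ) ^ l * h := by fun_prop
    simpa using this.tendsto 0
  filter_upwards [ht.eventually hf, hg] with u hu hu'
  rw [Function.comp_apply, hu', hu, Function.comp_apply, zpow_add₀ (by norm_num), mul_assoc]

lemma HasSlopeAt.real {f : UnitAddCircle → UnitAddCircle} {k : ℤ} {x : ℝ}
    (h : HasSlopeAt f k x) :
    ∀ᶠ y : ℝ in 𝓝 x, f y = f x + (((2 : ℝ) ^ k * (y - x) : ℝ) : UnitAddCircle) := by
  have ht : Tendsto (fun y : ℝ => y - x) (𝓝 x) (𝓝 0) := by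
    have : Continuous fun y : ℝ => y - x := by fun_prop
    simpa using this.tendsto x
  filter_upwards [ht.eventually h] with y hy
  rw [← hy, ← AddCircle.coe_add]
  congr 2
  ring

lemma IsDyadic.exists_real {y : ℝ} (h : IsDyadic (y : UnitAddCircle)) :
    ∃ (p : ℤ) (n : ℕ), y = p / 2 ^ n := by
  obtain ⟨p, n, h⟩ := h
  obtain ⟨m, hm⟩ := (AddCircle.coe_eq_zero_iff (1 : ℝ)).1
    (show ((y - p / 2 ^ n : ℝ) : UnitAddCircle) = 0 by rw [AddCircle.coe_sub, h, sub_self])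
  refine ⟨m * 2 ^ n + p, n, ?_⟩
  rw [zsmul_eq_mul, mul_one] at hm
  push_cast
  rw [add_div, mul_div_cancel_right₀ _ (by positivity), hm]
  ring

lemma isDyadic_of_apply {f : UnitAddCircle → UnitAddCircle}
    (hf : ∀ x, IsDyadic x → IsDyadic (f x)) {k : ℤ} {x : UnitAddCircle} (hk : HasSlopeAt f k x)
    (hx : IsDyadic (f x)) : IsDyadic x := by
  induction x using QuotientAddGroup.induction_on with
  | H y =>
    obtain ⟨p, n, h⟩ := exists_dyadic hk.real
    have h1 := isDyadic_sub (hf _ ⟨p, n, rfl⟩) hx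
    have h2 : f (((p / 2 ^ n : ℝ)) : UnitAddCircle) =
      f y + (((2 : ℝ) ^ k * ((p / 2 ^ n : ℝ) - y) : ℝ) : UnitAddCircle) := h
    rw [h2, add_sub_cancel_left] at h1
    obtain ⟨q, m, h3⟩ := h1.exists_real
    have h4 : y = p / 2 ^ n - 2 ^ (-k) * (q / 2 ^ m) := by
      rw [← h3, ← mul_assoc, ← zpow_add₀ (by norm_num), neg_add_cancel, zpow_zero, one_mul]
      ring
    have h5 := isDyadic_sub ⟨p, n, rfl⟩ (isDyadic_zpow (-k) q m)
    rw [← AddCircle.coe_sub, ← h4] at h5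
    exact h5

/-- The Thompson group `T`: the piecewise linear homeomorphisms of the circle `[0, 1] / (0 = 1)`
that map dyadic rationals to dyadic rationals, are differentiable except at finitely many dyadic
rationals, and have integer powers of `2` as slopes. -/
def ThompsonT : Subgroup (UnitAddCircle ≃ₜ UnitAddCircle) where
  carrier := {f | (∀ x, IsDyadic x → IsDyadic (f x)) ∧
    ∃ B : Finset UnitAddCircle, (∀ b ∈ B, IsDyadic b) ∧ ∀ x ∉ B, ∃ k : ℤ, HasSlopeAt f k x}
  one_mem' := ⟨fun _ h => h, ∅, by simp, fun x _ => ⟨0, Eventually.of_forall fun h => by simp⟩⟩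
  mul_mem' := by
    classical
    rintro f g ⟨hf, A, hA, hfA⟩ ⟨hg, B, hB, hgB⟩
    refine ⟨fun x hx => hf _ (hg _ hx), ?_⟩
    refine ⟨B ∪ (A.image g.symm), ?_, ?_⟩
    · intro b hb
      by_cases hbB : b ∈ B
      · exact hB b hbB
      obtain ⟨a, ha, rfl⟩ := Finset.mem_image.1 ((Finset.mem_union.1 hb).resolve_left hbB)
      obtain ⟨k, hk⟩ := hgB _ hbB
      refine isDyadic_of_apply hg hk ?_
      rw [g.apply_symm_apply]
      exact hA a ha
    · intro x hx
      simp only [Finset.mem_union, Finset.mem_image, not_or] at hx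
      obtain ⟨l, hl⟩ := hgB x hx.1
      obtain ⟨k, hk⟩ := hfA (g x) fun h => hx.2 ⟨_, h, g.symm_apply_apply x⟩
      exact ⟨k + l, hk.comp hl⟩
  inv_mem' := by
    classical
    rintro f ⟨hf, A, hA, hfA⟩
    refine ⟨?_, A.image f, ?_, ?_⟩
    · intro x hx
      by_cases hxA : f.symm x ∈ A
      · exact hA _ hxA
      · obtain ⟨k, hk⟩ := hfA _ hxA
        refine isDyadic_of_apply hf hk ?_
        change IsDyadic (f (f.symm x))
        rw [f.apply_symm_apply]
        exact hx
    · intro b hb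
      obtain ⟨a, ha, rfl⟩ := Finset.mem_image.1 hb
      exact hf a (hA a ha)
    · intro x hx
      obtain ⟨k, hk⟩ := hfA (f.symm x) fun h => hx (Finset.mem_image.2 ⟨_, h, f.apply_symm_apply x⟩)
      have := hk.symm
      rw [f.apply_symm_apply] at this
      exact ⟨-k, this⟩

/-! ### The action of `T` -/

/-- `f` maps the interval `i` affinely onto the interval `j`. -/
def MapsAffinely (f : UnitAddCircle ≃ₜ UnitAddCircle) (i j : DyadicInterval) : Prop :=
  ∀ t ∈ Ico (0 : ℝ) 1, f ((i.left + t * i.len : ℝ) : UnitAddCircle) =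
    ((j.left + t * j.len : ℝ) : UnitAddCircle)

lemma coe_inj {x y : ℝ} (hx : x ∈ Ico (0 : ℝ) 1) (hy : y ∈ Ico (0 : ℝ) 1)
    (h : (x : UnitAddCircle) = (y : UnitAddCircle)) : x = y := by
  have hx' : x ∈ Ico (0 : ℝ) (0 + 1) := by simpa using hx
  have hy' : y ∈ Ico (0 : ℝ) (0 + 1) := by simpa using hy
  exact (AddCircle.coe_eq_coe_iff_of_mem_Ico hx' hy').1 h

namespace DyadicInterval

lemma param_mem (i : DyadicInterval) {t : ℝ} (ht : t ∈ Ico (0 : ℝ) 1) :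
    i.left + t * i.len ∈ i.toSet := by
  have := i.len_pos
  constructor
  · nlinarith [ht.1]
  · nlinarith [ht.2]

lemma exists_param {i : DyadicInterval} {x : ℝ} (hx : x ∈ i.toSet) :
    ∃ t ∈ Ico (0 : ℝ) 1, x = i.left + t * i.len := by
  have h0 := i.len_pos
  refine ⟨(x - i.left) / i.len, ⟨div_nonneg (by linarith [hx.1]) h0.le, ?_⟩, ?_⟩
  · rw [div_lt_one h0]; linarith [hx.2]
  · field_simp; ring

end DyadicInterval

namespace MapsAffinely

variable {f g : UnitAddCircle ≃ₜ UnitAddCircle} {i j k : DyadicInterval}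

lemma exists_image (h : MapsAffinely f i j) {x : ℝ} (hx : x ∈ i.toSet) :
    ∃ y ∈ j.toSet, f (x : UnitAddCircle) = (y : UnitAddCircle) := by
  obtain ⟨t, ht, rfl⟩ := DyadicInterval.exists_param hx
  exact ⟨_, j.param_mem ht, h t ht⟩

lemma exists_preimage (h : MapsAffinely f i j) {y : ℝ} (hy : y ∈ j.toSet) :
    ∃ x ∈ i.toSet, f (x : UnitAddCircle) = (y : UnitAddCircle) := by
  obtain ⟨t, ht, rfl⟩ := DyadicInterval.exists_param hy
  exact ⟨_, i.param_mem ht, h t ht⟩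

lemma symm (h : MapsAffinely f i j) : MapsAffinely f.symm j i := fun t ht => by
  rw [← h t ht, f.symm_apply_apply]

lemma comp (hg : MapsAffinely g j k) (hf : MapsAffinely f i j) : MapsAffinely (g * f) i k :=
  fun t ht => by rw [← hg t ht, ← hf t ht]; rfl

lemma one (i : DyadicInterval) : MapsAffinely 1 i i := fun _ _ => rfl

lemma fst (h : MapsAffinely f i j) : MapsAffinely f i.fst j.fst := fun t ht => by
  have := h (t / 2) ⟨by linarith [ht.1], by linarith [ht.2]⟩
  rw [DyadicInterval.fst_left, DyadicInterval.fst_len, DyadicInterval.fst_left,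
    DyadicInterval.fst_len]
  convert this using 3 <;> ring

lemma snd (h : MapsAffinely f i j) : MapsAffinely f i.snd j.snd := fun t ht => by
  have := h ((t + 1) / 2) ⟨by linarith [ht.1], by linarith [ht.2]⟩
  rw [DyadicInterval.snd_left, DyadicInterval.snd_len, DyadicInterval.snd_left,
    DyadicInterval.snd_len]
  have e : ∀ a l : ℝ, a + l / 2 + t * (l / 2) = a + (t + 1) / 2 * l := fun a l => by ring
  rw [e, e]
  exact this

lemma subset {i' j' : DyadicInterval} (h : MapsAffinely f i j) (h' : MapsAffinely f i' j')
    (hs : i.toSet ⊆ i'.toSet) : j.toSet ⊆ j'.toSet := by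
  intro y hy
  obtain ⟨x, hx, hxy⟩ := h.exists_preimage hy
  obtain ⟨y', hy', hxy'⟩ := h'.exists_image (hs hx)
  rwa [coe_inj (j.toSet_subset hy) (j'.toSet_subset hy') (hxy.symm.trans hxy')]

lemma unique {j' : DyadicInterval} (h : MapsAffinely f i j) (h' : MapsAffinely f i j') : j = j' :=
  DyadicInterval.eq_of_subset (h'.subset h Subset.rfl) (h.subset h' Subset.rfl) |>.symm ▸ rfl

lemma injective {i' : DyadicInterval} (h : MapsAffinely f i j) (h' : MapsAffinely f i' j) :
    i = i' := h.symm.unique h'.symm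

end MapsAffinely

/-- `f` maps each interval `i` of `I` affinely onto the interval `e i` of `J`; in particular
`f(I) = J`. -/
def Carries (f : UnitAddCircle ≃ₜ UnitAddCircle) (I J : DyadicPartition)
    (e : I.parts ≃ J.parts) : Prop :=
  ∀ i : I.parts, MapsAffinely f i (e i)

lemma carries_of_forall {f : UnitAddCircle ≃ₜ UnitAddCircle} {I : DyadicPartition}
    (h : ∀ i ∈ I.parts, ∃ j, MapsAffinely f i j) :
    ∃ (J : DyadicPartition) (e : I.parts ≃ J.parts), Carries f I J e := by
  classical
  have h' : ∀ i : I.parts, ∃ j, MapsAffinely f i j := fun i => h i i.2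
  choose φ hφ using h'
  let J : DyadicPartition :=
    { parts := Finset.univ.image φ
      existsUnique_mem := by
        intro y hy
        obtain ⟨x, hx, hxy⟩ : ∃ x ∈ Ico (0 : ℝ) 1, f (x : UnitAddCircle) = (y : UnitAddCircle) := by
          obtain ⟨x, hx⟩ := QuotientAddGroup.mk_surjective (f.symm (y : UnitAddCircle))
          refine ⟨Int.fract x, ⟨Int.fract_nonneg x, Int.fract_lt_one x⟩, ?_⟩
          have e : ((Int.fract x : ℝ) : UnitAddCircle) = (x : UnitAddCircle) := by
            rw [Int.fract, AddCircle.coe_sub, sub_eq_self, AddCircle.coe_eq_zero_iff]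
            exact ⟨⌊x⌋, by simp⟩
          rw [e]
          exact (congrArg f hx).trans (f.apply_symm_apply _)
        obtain ⟨i, ⟨hi, hxi⟩, hu⟩ := I.existsUnique_mem x hx
        refine ⟨φ ⟨i, hi⟩, ⟨Finset.mem_image_of_mem _ (Finset.mem_univ _), ?_⟩, ?_⟩
        · obtain ⟨y', hy', hxy'⟩ := (hφ ⟨i, hi⟩).exists_image hxi
          rwa [coe_inj hy (DyadicInterval.toSet_subset _ hy') (hxy.symm.trans hxy')]
        · rintro j ⟨hj, hyj⟩
          obtain ⟨i', -, rfl⟩ := Finset.mem_image.1 hj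
          obtain ⟨x', hx', hxy'⟩ := (hφ i').exists_preimage hyj
          have : x' = x := coe_inj (DyadicInterval.toSet_subset _ hx') hx
            (f.injective (hxy'.trans hxy.symm))
          have := hu i' ⟨i'.2, this ▸ hx'⟩
          congr 1
          exact Subtype.ext this }
  have hJ : ∀ i, φ i ∈ J.parts := fun i => Finset.mem_image_of_mem _ (Finset.mem_univ _)
  refine ⟨J, Equiv.ofBijective (fun i => ⟨φ i, hJ i⟩) ⟨?_, ?_⟩, fun i => hφ i⟩
  · intro i i' hii
    have e : φ i = φ i' := congrArg Subtype.val hii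
    exact Subtype.ext ((hφ i).injective (e ▸ hφ i'))
  · rintro ⟨j, hj⟩
    obtain ⟨i, -, rfl⟩ := Finset.mem_image.1 hj
    exact ⟨i, rfl⟩

namespace Carries

variable {f g : UnitAddCircle ≃ₜ UnitAddCircle} {I J K L : DyadicPartition}
  {e : I.parts ≃ J.parts}

lemma refine (h : Carries f I J e) (hIK : I ≤ K) :
    ∃ (L : DyadicPartition) (e' : K.parts ≃ L.parts), J ≤ L ∧ Carries f K L e' := by
  obtain ⟨L, e', he'⟩ := carries_of_forall (f := f) (I := K) (by
    intro k hk
    obtain ⟨i, hi, hs⟩ := DyadicPartition.le_iff.1 hIK k hk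
    exact DyadicInterval.descend (P := fun i => ∃ j, MapsAffinely f i j)
      (fun i ⟨j, h⟩ => ⟨_, h.fst⟩) (fun i ⟨j, h⟩ => ⟨_, h.snd⟩) ⟨_, h ⟨i, hi⟩⟩ hs)
  refine ⟨L, e', DyadicPartition.le_iff.2 fun l hl => ?_, he'⟩
  obtain ⟨k, hk⟩ := e'.surjective ⟨l, hl⟩
  obtain ⟨i, hi, hs⟩ := DyadicPartition.le_iff.1 hIK k k.2
  have h1 := he' k
  rw [hk] at h1
  exact ⟨e ⟨i, hi⟩, (e ⟨i, hi⟩).2, h1.subset (h ⟨i, hi⟩) hs⟩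

lemma symm (h : Carries f I J e) : Carries f.symm J I e.symm := fun j => by
  have := (h (e.symm j)).symm
  rwa [e.apply_symm_apply] at this

lemma comp {e' : J.parts ≃ K.parts} (hg : Carries g J K e') (hf : Carries f I J e) :
    Carries (g * f) I K (e.trans e') := fun i => (hg (e i)).comp (hf i)

lemma one (I : DyadicPartition) : Carries 1 I I (Equiv.refl _) := fun i => MapsAffinely.one i

lemma target_unique {J' : DyadicPartition} {e' : I.parts ≃ J'.parts} (h : Carries f I J e)
    (h' : Carries f I J' e') : J = J' := by
  refine DyadicPartition.ext_of_subset fun j hj => ?_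
  obtain ⟨i, hi⟩ := e.surjective ⟨j, hj⟩
  have h1 := h i
  rw [hi] at h1
  have h2 : j = e' i := h1.unique (h' i)
  rw [h2]
  exact (e' i).2

lemma equiv_unique {e' : I.parts ≃ J.parts} (h : Carries f I J e)
    (h' : Carries f I J e') : e = e' :=
  Equiv.ext fun i => Subtype.ext ((h i).unique (h' i))

lemma contract_eq (V : SpinIsometry d) (h : Carries f I J e) (w w' : DyadicInterval → Fin d → ℂ)
    (hw : ∀ i : I.parts, w' (e i) = w i) {i j : DyadicInterval}
    (hi : DyadicPartition.Sub I.parts i) (hij : MapsAffinely f i j) :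
    contract V J.parts w' j = contract V I.parts w i := by
  induction hi generalizing j with
  | @mem i hi =>
    have := hij.unique (h ⟨i, hi⟩)
    subst this
    rw [contract_mem V _ (e ⟨i, hi⟩).2, contract_mem V _ hi, hw]
  | @split i h1 h2 h3 h4 ih1 ih2 =>
    have hj : DyadicPartition.Sub J.parts j := by
      obtain ⟨k, hk, hs⟩ := (DyadicPartition.Sub.split h1 h2 h3 h4).exists
      exact J.sub_of_subset (e ⟨k, hk⟩).2 ((h ⟨k, hk⟩).subset hij hs)
    funext k
    cases hj with
    | mem hj =>
      exfalso
      obtain ⟨i', hi'⟩ := e.surjective ⟨j, hj⟩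
      have h5 := h i'
      rw [hi'] at h5
      exact h1 (hij.injective h5 ▸ i'.2)
    | split h1' h2' _ _ =>
      rw [contract_split V _ h1 h2, contract_split V _ h1' h2', ih1 hij.fst, ih2 hij.snd]

end Carries

/-- Relabel the tensor factors along a bijection of the intervals. -/
def relabel {I J : DyadicPartition} (e : I.parts ≃ J.parts) :
    SpinSpace d I ≃ₗᵢ[ℂ] SpinSpace d J :=
  LinearIsometryEquiv.piLpCongrLeft 2 ℂ ℂ (Equiv.arrowCongr e (Equiv.refl (Fin d)))

lemma relabel_apply {I J : DyadicPartition} (e : I.parts ≃ J.parts) (x : SpinSpace d I)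
    (c : J.parts → Fin d) : relabel e x c = x (c ∘ e) := by
  simp [relabel, LinearIsometryEquiv.piLpCongrLeft_apply, Equiv.piCongrLeft', Function.comp_def]
  rfl

lemma relabel_refine (V : SpinIsometry d) {f : UnitAddCircle ≃ₜ UnitAddCircle}
    {I J K L : DyadicPartition} {e : I.parts ≃ J.parts} {e' : K.parts ≃ L.parts}
    (h : Carries f I J e) (h' : Carries f K L e') (hIK : I ≤ K) (x : SpinSpace d I) :
    refineLin V J L (relabel e x) = relabel e' (refineLin V I K x) := by
  ext c
  rw [relabel_apply, refineLin_apply, refineLin_apply]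
  refine Fintype.sum_equiv (Equiv.arrowCongr e.symm (Equiv.refl (Fin d))) _ _ fun a => ?_
  rw [relabel_apply]
  congr 1
  rw [refineEntry, refineEntry, ← Equiv.prod_comp e]
  refine Finset.prod_congr rfl fun i _ => ?_
  rw [h'.contract_eq V (leafCovector (c ∘ e')) (leafCovector c) ?_
    (DyadicPartition.sub_of_le hIK i.2) (h i)]
  · rfl
  · intro k
    funext q
    simp [leafCovector]

/-! Every element of `T` maps all sufficiently small standard dyadic intervals affinely onto
standard dyadic intervals. -/

lemma eq_zero_of_eventually {c : ℝ} (h : ∀ᶠ u : ℝ in 𝓝 0, ((c * u : ℝ) : UnitAddCircle) = 0) :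
    c = 0 := by
  by_contra hc
  obtain ⟨ε, hε, h⟩ := Metric.eventually_nhds_iff.1 h
  set u := min (ε / 2) (1 / (2 * |c|)) with hu
  have hc' : 0 < |c| := abs_pos.2 hc
  have hu0 : 0 < u := by rw [hu]; positivity
  have h1 : u < ε := (min_le_left _ _).trans_lt (by linarith)
  have h2 : |c| * u ≤ 1 / 2 := by
    calc |c| * u ≤ |c| * (1 / (2 * |c|)) := by gcongr; exact min_le_right _ _
      _ = 1 / 2 := by field_simp
  have h3 := h (y := u) (by simpa [Real.dist_eq, abs_of_pos hu0] using h1)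
  obtain ⟨m, hm⟩ := (AddCircle.coe_eq_zero_iff (1 : ℝ)).1 h3
  rw [zsmul_eq_mul, mul_one] at hm
  have h4 : |(m : ℝ)| < 1 := by
    rw [hm, abs_mul, abs_of_pos hu0]; linarith
  have h5 : m = 0 := by
    have : |m| < 1 := by exact_mod_cast h4
    exact Int.abs_lt_one_iff.1 this
  rw [h5, Int.cast_zero] at hm
  rcases mul_eq_zero.1 hm.symm with h | h
  · exact hc h
  · exact hu0.ne' h

lemma exists_slope {f : UnitAddCircle ≃ₜ UnitAddCircle} {a b : ℝ} (hab : a < b)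
    (h : ∀ x ∈ Ioo a b, ∃ k : ℤ, HasSlopeAt f k (x : UnitAddCircle)) :
    ∃ k : ℤ, ∀ x ∈ Icc a b, f (x : UnitAddCircle) =
      f (a : UnitAddCircle) + (((2 : ℝ) ^ k * (x - a) : ℝ) : UnitAddCircle) := by
  obtain ⟨m, hm⟩ := nonempty_Ioo.2 hab
  obtain ⟨k, hk⟩ := h m hm
  let P : ℝ → Prop := fun y => f (y : UnitAddCircle) =
    f (m : UnitAddCircle) + (((2 : ℝ) ^ k * (y - m) : ℝ) : UnitAddCircle)
  let u : Set ℝ := {x | ∀ᶠ y in 𝓝 x, P y}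
  have hsub : Ioo a b ⊆ u := by
    refine isPreconnected_Ioo.subset_of_closure_inter_subset isOpen_setOfPred_eventually_nhds
      ⟨m, hm, hk.real⟩ ?_
    rintro x ⟨hxu, hx⟩
    obtain ⟨k', hk'⟩ := h x hx
    have hk'' := hk'.real
    obtain ⟨z, hzu, hz⟩ : ∃ z : ℝ, z ∈ u ∧ ∀ᶠ y : ℝ in 𝓝 z, f (y : UnitAddCircle) =
        f (x : UnitAddCircle) + (((2 : ℝ) ^ k' * (y - x) : ℝ) : UnitAddCircle) := by
      obtain ⟨z, hz, hzu⟩ := (mem_closure_iff_nhds.1 hxu) _ hk''.eventually_nhds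
      exact ⟨z, hzu, hz⟩
    have hz1 : f (z : UnitAddCircle) =
        f (m : UnitAddCircle) + (((2 : ℝ) ^ k * (z - m) : ℝ) : UnitAddCircle) := hzu.self_of_nhds
    have hz2 := hz.self_of_nhds
    have hslope : (2 : ℝ) ^ k - 2 ^ k' = 0 := by
      apply eq_zero_of_eventually
      have ht : Tendsto (fun v : ℝ => z + v) (𝓝 0) (𝓝 z) := by
        have : Continuous fun v : ℝ => z + v := by fun_prop
        simpa using this.tendsto 0
      filter_upwards [ht.eventually hzu, ht.eventually hz] with v hv1 hv2
      have e1 : (((2 : ℝ) ^ k * (z + v - m) : ℝ) : UnitAddCircle) =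
          (((2 : ℝ) ^ k * (z - m) : ℝ) : UnitAddCircle) +
            (((2 : ℝ) ^ k * v : ℝ) : UnitAddCircle) := by
        rw [← AddCircle.coe_add]; congr 1; ring
      have e2 : (((2 : ℝ) ^ k' * (z + v - x) : ℝ) : UnitAddCircle) =
          (((2 : ℝ) ^ k' * (z - x) : ℝ) : UnitAddCircle) +
            (((2 : ℝ) ^ k' * v : ℝ) : UnitAddCircle) := by
        rw [← AddCircle.coe_add]; congr 1; ring
      replace hv1 : f ((z + v : ℝ) : UnitAddCircle) = f (m : UnitAddCircle) +
        (((2 : ℝ) ^ k * (z + v - m) : ℝ) : UnitAddCircle) := hv1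
      rw [e1, ← add_assoc, ← hz1] at hv1
      rw [e2, ← add_assoc, ← hz2, hv1] at hv2
      rw [sub_mul, AddCircle.coe_sub, add_left_cancel hv2, sub_self]
    rw [sub_eq_zero] at hslope
    have hxm : f (x : UnitAddCircle) =
        f (m : UnitAddCircle) + (((2 : ℝ) ^ k * (x - m) : ℝ) : UnitAddCircle) := by
      rw [hz1, ← hslope] at hz2
      have e : (((2 : ℝ) ^ k * (z - m) : ℝ) : UnitAddCircle) =
          (((2 : ℝ) ^ k * (x - m) : ℝ) : UnitAddCircle) +
            (((2 : ℝ) ^ k * (z - x) : ℝ) : UnitAddCircle) := by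
        rw [← AddCircle.coe_add]; congr 1; ring
      rw [e, ← add_assoc] at hz2
      exact (add_right_cancel hz2).symm
    change ∀ᶠ y in 𝓝 x, P y
    filter_upwards [hk''] with y hy
    simp only [P]
    rw [hy, hxm, ← hslope, add_assoc, ← AddCircle.coe_add]
    congr 2
    ring
  have hcl : IsClosed {y : ℝ | P y} := by
    have hc : Continuous fun y : ℝ => (y : UnitAddCircle) := AddCircle.continuous_mk' 1
    refine isClosed_eq (f.continuous.comp hc) (continuous_const.add (hc.comp ?_))
    fun_prop
  have hIcc : Icc a b ⊆ {y : ℝ | P y} := by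
    rw [← closure_Ioo hab.ne]
    exact closure_minimal (fun x hx => (hsub hx).self_of_nhds) hcl
  refine ⟨k, fun x hx => ?_⟩
  have h1 : P x := hIcc hx
  have h2 : P a := hIcc ⟨le_rfl, hab.le⟩
  simp only [P] at h1 h2
  rw [h1, h2, add_assoc, ← AddCircle.coe_add]
  congr 2
  ring

lemma exists_common_level (B : Finset UnitAddCircle) (hB : ∀ b ∈ B, IsDyadic b) :
    ∃ n : ℕ, ∀ b ∈ B, ∃ p : ℤ, b = ((p / 2 ^ n : ℝ) : UnitAddCircle) := by
  choose! p n h using hB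
  refine ⟨B.sup n, fun b hb => ⟨p b * 2 ^ (B.sup n - n b), ?_⟩⟩
  conv_lhs => rw [h b hb]
  congr 1
  have : B.sup n = n b + (B.sup n - n b) := by have := Finset.le_sup (f := n) hb; omega
  push_cast
  conv_rhs => rw [this, pow_add]
  rw [Nat.add_sub_cancel_left]
  field_simp

lemma exists_level {f : UnitAddCircle ≃ₜ UnitAddCircle} (hf : f ∈ ThompsonT) :
    ∃ n : ℕ, ∀ j : DyadicInterval, n ≤ j.level → ∃ j', MapsAffinely f j j' := by
  obtain ⟨hd, B, hB, hs⟩ := hf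
  obtain ⟨N, hN⟩ := exists_common_level B hB
  have key : ∀ i ∈ (DyadicPartition.uniform N).parts, ∃ n : ℕ, ∀ j : DyadicInterval,
      j.toSet ⊆ i.toSet → n ≤ j.level → ∃ j', MapsAffinely f j j' := by
    intro i hi
    have hiN := DyadicPartition.mem_uniform.1 hi
    have hlen := i.len_pos
    obtain ⟨k, hk⟩ : ∃ k : ℤ, ∀ x ∈ Icc i.left (i.left + i.len), f (x : UnitAddCircle) =
        f (i.left : UnitAddCircle) + (((2 : ℝ) ^ k * (x - i.left) : ℝ) : UnitAddCircle) := by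
      refine exists_slope (by linarith) fun x hx => hs _ fun hxB => ?_
      obtain ⟨p, hp⟩ := hN _ hxB
      obtain ⟨m, hm⟩ := (AddCircle.coe_eq_zero_iff (1 : ℝ)).1
        (show ((x - p / 2 ^ N : ℝ) : UnitAddCircle) = 0 by rw [AddCircle.coe_sub, hp, sub_self])
      rw [zsmul_eq_mul, mul_one] at hm
      have h0 : (0 : ℝ) < 2 ^ N := by positivity
      have hx' : x * 2 ^ N = ((m * 2 ^ N + p : ℤ) : ℝ) := by
        push_cast
        rw [hm]; field_simp; ring
      have h1 : (i.idx : ℝ) < x * 2 ^ N := by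
        have := hx.1
        rwa [DyadicInterval.left, hiN, div_lt_iff₀ h0] at this
      have h2 : x * 2 ^ N < (i.idx : ℝ) + 1 := by
        have := hx.2
        rwa [DyadicInterval.left, DyadicInterval.len, hiN, ← add_div, lt_div_iff₀ h0] at this
      rw [hx'] at h1 h2
      have h3 : (i.idx : ℤ) < m * 2 ^ N + p := by exact_mod_cast h1
      have h4 : m * 2 ^ N + p < (i.idx : ℤ) + 1 := by exact_mod_cast h2
      omega
    obtain ⟨q, M, hq⟩ := hd (i.left : UnitAddCircle) ⟨i.idx, i.level, by simp [DyadicInterval.left]⟩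
    refine ⟨max N (k + M).toNat + k.toNat, fun j hj hjl => ?_⟩
    obtain ⟨L, hL⟩ : ∃ L : ℕ, (L : ℤ) = j.level - k := ⟨(j.level - k).toNat, by omega⟩
    have hML : M ≤ L := by omega
    have hNj : N ≤ j.level := by omega
    have hL2 : (2 : ℝ) ^ k * (1 / 2 ^ j.level) = 1 / 2 ^ L := by
      have : k = j.level - (L : ℤ) := by omega
      rw [this, zpow_sub₀ (by norm_num), zpow_natCast, zpow_natCast]
      field_simp
    -- the image of the left endpoint, as a multiple of `1 / 2 ^ L`
    set s : ℤ := q * 2 ^ (L - M) + (j.idx - i.idx * 2 ^ (j.level - N)) with hsdef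
    have hleft : f (j.left : UnitAddCircle) = ((s / 2 ^ L : ℝ) : UnitAddCircle) := by
      have hmem : j.left ∈ Icc i.left (i.left + i.len) := Ico_subset_Icc_self (hj j.left_mem)
      rw [hk _ hmem, hq, ← AddCircle.coe_add]
      congr 1
      have e1 : j.left - i.left =
          (1 / 2 ^ j.level) * ((j.idx : ℝ) - i.idx * 2 ^ (j.level - N)) := by
        have : (2 : ℝ) ^ j.level = 2 ^ N * 2 ^ (j.level - N) := by
          rw [← pow_add]; congr 1; omega
        rw [DyadicInterval.left, DyadicInterval.left, hiN, this]
        field_simp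
      have e2 : (2 : ℝ) ^ L = 2 ^ M * 2 ^ (L - M) := by rw [← pow_add]; congr 1; omega
      rw [e1, ← mul_assoc, hL2, hsdef, e2]
      push_cast
      field_simp
    have hpos : (0 : ℤ) < 2 ^ L := by positivity
    refine ⟨⟨L, (s % 2 ^ L).toNat, ?_⟩, fun t ht => ?_⟩
    · have h1 := Int.emod_nonneg s hpos.ne'
      have h2 := Int.emod_lt_of_pos s hpos
      zify
      rw [Int.toNat_of_nonneg h1]
      exact h2
    · have hmem1 := Ico_subset_Icc_self (hj (j.param_mem ht))
      have hmem2 := Ico_subset_Icc_self (hj j.left_mem)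
      have e0 : (((s % 2 ^ L).toNat : ℕ) : ℝ) = s - 2 ^ L * ((s / 2 ^ L : ℤ) : ℝ) := by
        have h1 := Int.emod_nonneg s hpos.ne'
        have h2 : (((s % 2 ^ L).toNat : ℕ) : ℤ) = s - 2 ^ L * (s / 2 ^ L) := by
          rw [Int.toNat_of_nonneg h1, Int.emod_def]
        exact_mod_cast h2
      have e1 : f ((j.left + t * j.len : ℝ) : UnitAddCircle) =
          f (j.left : UnitAddCircle) + (((2 : ℝ) ^ k * (t * j.len) : ℝ) : UnitAddCircle) := by
        rw [hk _ hmem1, hk _ hmem2, add_assoc, ← AddCircle.coe_add]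
        congr 2
        ring
      have e2 : (2 : ℝ) ^ k * (t * j.len) = t * (1 / 2 ^ L) := by
        rw [← hL2, DyadicInterval.len]; ring
      rw [e1, hleft, ← AddCircle.coe_add, e2, ← sub_eq_zero, ← AddCircle.coe_sub,
        AddCircle.coe_eq_zero_iff]
      refine ⟨s / 2 ^ L, ?_⟩
      simp only [DyadicInterval.left, DyadicInterval.len]
      rw [e0, zsmul_eq_mul, mul_one]
      field_simp
      ring
  choose! n hn using key
  refine ⟨max N ((DyadicPartition.uniform N).parts.sup n), fun j hj => ?_⟩
  obtain ⟨i, ⟨hi, hx⟩, -⟩ :=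
    (DyadicPartition.uniform N).existsUnique_mem _ (j.toSet_subset j.left_mem)
  refine hn i hi j (DyadicInterval.subset_of_mem hx j.left_mem ?_) ?_
  · rw [DyadicPartition.mem_uniform.1 hi]; exact (le_max_left _ _).trans hj
  · exact ((Finset.le_sup (f := n) hi).trans (le_max_right _ _)).trans hj

/-- Every partition has a refinement that `f` maps to a partition. -/
lemma exists_carries {f : UnitAddCircle ≃ₜ UnitAddCircle} (hf : f ∈ ThompsonT)
    (I : DyadicPartition) :
    ∃ (K J : DyadicPartition) (e : K.parts ≃ J.parts), I ≤ K ∧ Carries f K J e := by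
  obtain ⟨n, hn⟩ := exists_level hf
  let N := max n (DyadicPartition.depth I.parts)
  obtain ⟨J, e, h⟩ := carries_of_forall (f := f) (I := DyadicPartition.uniform N) fun i hi =>
    hn i ((DyadicPartition.mem_uniform.1 hi).symm ▸ le_max_left _ _)
  exact ⟨_, J, e, DyadicPartition.le_uniform fun i hi =>
    (DyadicPartition.level_le_depth hi).trans (le_max_right _ _), h⟩

open UniformSpace in
/-- The continuous extension of a linear isometry to the completion. -/
def completionMap {E : Type*} [NormedAddCommGroup E] [NormedSpace ℂ E] (L : E →ₗᵢ[ℂ] E) :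
    Completion E →ₗᵢ[ℂ] Completion E where
  toFun := Completion.map L
  map_add' x y := by
    have hc : Continuous (Completion.map L) := Completion.continuous_map
    induction x, y using Completion.induction_on₂ with
    | hp =>
      have h1 : Continuous fun p : Completion E × Completion E => Completion.map L (p.1 + p.2) :=
        hc.comp continuous_add
      have h2 : Continuous fun p : Completion E × Completion E =>
          Completion.map L p.1 + Completion.map L p.2 :=
        continuous_add.comp ((hc.comp continuous_fst).prodMk (hc.comp continuous_snd))
      exact isClosed_eq h1 h2
    | ih a b =>
      rw [← Completion.coe_add, Completion.map_coe L.isometry.uniformContinuous,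
        Completion.map_coe L.isometry.uniformContinuous,
        Completion.map_coe L.isometry.uniformContinuous, map_add, Completion.coe_add]
  map_smul' r x := by
    have hc : Continuous (Completion.map L) := Completion.continuous_map
    induction x using Completion.induction_on with
    | hp =>
      have h1 : Continuous fun p : Completion E => Completion.map L (r • p) :=
        hc.comp (continuous_const_smul r)
      have h2 : Continuous fun p : Completion E => r • Completion.map L p :=
        (continuous_const_smul r).comp hc
      exact isClosed_eq h1 h2
    | ih a =>
      rw [← Completion.coe_smul, Completion.map_coe L.isometry.uniformContinuous,
        Completion.map_coe L.isometry.uniformContinuous, map_smul, Completion.coe_smul]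
      rfl
  norm_map' x := by
    change ‖Completion.map L x‖ = ‖x‖
    induction x using Completion.induction_on with
    | hp => exact isClosed_eq Completion.continuous_map.norm continuous_norm
    | ih a =>
      rw [Completion.map_coe L.isometry.uniformContinuous, Completion.norm_coe,
        Completion.norm_coe, L.norm_map]

lemma completionMap_coe {E : Type*} [NormedAddCommGroup E] [NormedSpace ℂ E] (L : E →ₗᵢ[ℂ] E) (z : E) :
    completionMap L (z : UniformSpace.Completion E) = (L z : E) :=
  UniformSpace.Completion.map_coe L.isometry.uniformContinuous z

section Action

variable (V : SpinIsometry d)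

/-- A refinement `src` of `I` that is carried to a partition `tgt = f(src)` by `f`. -/
structure CarriedRefinement (f : UnitAddCircle ≃ₜ UnitAddCircle) (I : DyadicPartition) where
  src : DyadicPartition
  tgt : DyadicPartition
  le : I ≤ src
  e : src.parts ≃ tgt.parts
  carries : Carries f src tgt e

/-- Refine `x ∈ (ℂ^d)^{⊗ I}`, relabel the tensor factors along `f`, and take the class. -/
def CarriedRefinement.act {f : UnitAddCircle ≃ₜ UnitAddCircle} {I : DyadicPartition}
    (C : CarriedRefinement f I) (x : SpinSpace d I) : PreLimit V :=
  PreLimit.mk V C.tgt (relabel C.e (refine V I C.src C.le x))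

lemma CarriedRefinement.act_eq {f : UnitAddCircle ≃ₜ UnitAddCircle} {I : DyadicPartition}
    (C C' : CarriedRefinement f I) (x : SpinSpace d I) : C.act V x = C'.act V x := by
  obtain ⟨K, h1, h2⟩ := exists_ge_ge C.src C'.src
  obtain ⟨L, e, hL, he⟩ := C.carries.refine h1
  obtain ⟨L', e', hL', he'⟩ := C'.carries.refine h2
  obtain rfl := he.target_unique he'
  obtain rfl := he.equiv_unique he'
  unfold act
  rw [← PreLimit.mk_refine V hL, ← PreLimit.mk_refine V hL', refine_apply, refine_apply,
    relabel_refine V C.carries he h1, relabel_refine V C'.carries he' h2,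
    refineLin_trans V C.le h1, refineLin_trans V C'.le h2]

lemma nonempty_carriedRefinement (f : ThompsonT) (I : DyadicPartition) :
    Nonempty (CarriedRefinement f.1 I) := by
  obtain ⟨K, J, e, h, he⟩ := exists_carries f.2 I
  exact ⟨⟨K, J, h, e, he⟩⟩

/-- The action of `f ∈ T` on classes. -/
def preAct (f : ThompsonT) (z : PreLimit V) : PreLimit V :=
  DirectLimit.lift (fun I J h => refine V I J h)
    (fun I x => (nonempty_carriedRefinement f I).some.act V x)
    (fun I J h x => by
      let C := (nonempty_carriedRefinement f J).some
      let C' : CarriedRefinement f.1 I := ⟨C.src, C.tgt, h.trans C.le, C.e, C.carries⟩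
      rw [CarriedRefinement.act_eq V _ C']
      change C'.act V x = C.act V _
      simp only [CarriedRefinement.act, refine_apply]
      rw [refineLin_trans V h C.le]) z

lemma preAct_mk (f : ThompsonT) {I : DyadicPartition} (C : CarriedRefinement f.1 I)
    (x : SpinSpace d I) : preAct V f (PreLimit.mk V I x) = C.act V x :=
  CarriedRefinement.act_eq V _ C x

/-- If `f(I) = J`, then `f` acts on `(ℂ^d)^{⊗ I}` by relabelling the tensor factors. -/
lemma preAct_of_carries (f : ThompsonT) {I J : DyadicPartition} {e : I.parts ≃ J.parts}
    (h : Carries f.1 I J e) (x : SpinSpace d I) :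
    preAct V f (PreLimit.mk V I x) = PreLimit.mk V J (relabel e x) := by
  rw [preAct_mk V f ⟨I, J, le_rfl, e, h⟩]
  simp only [CarriedRefinement.act, refine_apply, refineLin_self]

lemma preAct_one (z : PreLimit V) : preAct V 1 z = z := by
  induction z using PreLimit.ind with
  | h I x =>
    rw [preAct_of_carries V 1 (Carries.one I)]
    rfl

lemma preAct_mul (f g : ThompsonT) (z : PreLimit V) :
    preAct V (f * g) z = preAct V f (preAct V g z) := by
  induction z using PreLimit.ind with
  | h I x =>
    obtain ⟨R⟩ := nonempty_carriedRefinement g I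
    obtain ⟨R'⟩ := nonempty_carriedRefinement f R.tgt
    obtain ⟨L, e, hL, he⟩ := R.carries.symm.refine R'.le
    have hg : Carries g.1 L R'.src e.symm := he.symm
    rw [← PreLimit.mk_refine V (R.le.trans hL), preAct_of_carries V g hg,
      preAct_of_carries V f R'.carries, preAct_of_carries V (f * g) (R'.carries.comp hg)]
    rfl

lemma preAct_inner (f : ThompsonT) (z w : PreLimit V) :
    inner ℂ (preAct V f z) (preAct V f w) = inner ℂ z w := by
  induction z, w using PreLimit.ind₂ with
  | h I x y =>
    obtain ⟨R⟩ := nonempty_carriedRefinement f I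
    rw [preAct_mk V f R, preAct_mk V f R, CarriedRefinement.act, CarriedRefinement.act,
      PreLimit.inner_mk, PreLimit.inner_mk, LinearIsometryEquiv.inner_map_map,
      LinearIsometry.inner_map_map]

/-- The action of `f ∈ T` on classes, as a linear isometry. -/
def preRep (f : ThompsonT) : PreLimit V →ₗᵢ[ℂ] PreLimit V :=
  LinearMap.isometryOfInner
    { toFun := preAct V f
      map_add' := fun z w => by
        induction z, w using PreLimit.ind₂ with
        | h I x y =>
          obtain ⟨R⟩ := nonempty_carriedRefinement f I
          rw [PreLimit.mk_add, preAct_mk V f R, preAct_mk V f R, preAct_mk V f R]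
          simp only [CarriedRefinement.act, map_add, PreLimit.mk_add]
      map_smul' := fun r z => by
        induction z using PreLimit.ind with
        | h I x =>
          obtain ⟨R⟩ := nonempty_carriedRefinement f I
          rw [PreLimit.mk_smul, preAct_mk V f R, preAct_mk V f R]
          simp only [CarriedRefinement.act, map_smul, PreLimit.mk_smul, RingHom.id_apply] }
    (preAct_inner V f)

lemma preRep_apply (f : ThompsonT) (z : PreLimit V) : preRep V f z = preAct V f z := rfl

lemma completionMap_preRep_one (x : SemicontinuousLimit V) : completionMap (preRep V 1) x = x := by
  induction x using UniformSpace.Completion.induction_on with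
  | hp => exact isClosed_eq (completionMap _).continuous continuous_id
  | ih a => rw [completionMap_coe, preRep_apply, preAct_one]

lemma completionMap_preRep_mul (f g : ThompsonT) (x : SemicontinuousLimit V) :
    completionMap (preRep V (f * g)) x = completionMap (preRep V f) (completionMap (preRep V g) x) := by
  induction x using UniformSpace.Completion.induction_on with
  | hp =>
    exact isClosed_eq (completionMap _).continuous
      ((completionMap _).continuous.comp (completionMap _).continuous)
  | ih a => simp only [completionMap_coe, preRep_apply, preAct_mul]

/-- Jones' unitary representation `ρ^V` of the Thompson group `T` on the semicontinuous limit: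
`ρ^V(f) [Ψ] = [Ψ']`, where `Ψ ∈ (ℂ^d)^{⊗ I}` is first refined so that `f(I)` is a standard dyadic
partition, and `Ψ'` results from relabelling the tensor factors according to `f`. -/
def rho : ThompsonT →* (SemicontinuousLimit V ≃ₗᵢ[ℂ] SemicontinuousLimit V) where
  toFun f :=
    { toLinearEquiv := LinearEquiv.ofLinearMap (completionMap (preRep V f)).toLinearMap
        (completionMap (preRep V f⁻¹)).toLinearMap
        (LinearMap.ext fun x => by
          change completionMap (preRep V f) (completionMap (preRep V f⁻¹) x) = x
          rw [← completionMap_preRep_mul, mul_inv_cancel, completionMap_preRep_one])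
        (LinearMap.ext fun x => by
          change completionMap (preRep V f⁻¹) (completionMap (preRep V f) x) = x
          rw [← completionMap_preRep_mul, inv_mul_cancel, completionMap_preRep_one])
      norm_map' := (completionMap (preRep V f)).norm_map }
  map_one' := LinearIsometryEquiv.ext (completionMap_preRep_one V)
  map_mul' f g := LinearIsometryEquiv.ext (completionMap_preRep_mul V f g)

/-- The defining property of `ρ^V`. -/
lemma rho_mk (f : ThompsonT) {I J : DyadicPartition} {e : I.parts ≃ J.parts}
    (h : Carries f.1 I J e) (x : SpinSpace d I) :
    rho V f (PreLimit.mk V I x : PreLimit V) = (PreLimit.mk V J (relabel e x) : PreLimit V) := by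
  change completionMap (preRep V f) _ = _
  rw [completionMap_coe, preRep_apply, preAct_of_carries V f h]

/-- The uniform distance `‖f - id‖_∞` of `f` to the identity, with respect to the metric of the
circle. -/
def supDistId (f : ThompsonT) : ℝ := ⨆ x : UnitAddCircle, ‖f.1 x - x‖

/-- Weak discontinuity of `ρ^V` at the identity. -/
def WeaklyDiscontinuousAtId : Prop :=
  ∃ f : ℕ → ThompsonT, Tendsto (fun k => supDistId (f k)) atTop (𝓝 0) ∧
    ∃ Φ Ψ : SemicontinuousLimit V,
      ¬ Tendsto (fun k => inner ℂ Φ (rho V (f k) Ψ)) atTop (𝓝 (inner ℂ Φ Ψ))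

end Action

/-! ### The Haar measure on isometries -/

/-- The isometry that is given by the first `d` columns of a unitary `d² × d²` matrix. The basis
`e_p ⊗ e_q` is ordered lexicographically. -/
def firstColumns (U : Matrix.unitaryGroup (Fin d × Fin d) ℂ) : SpinIsometry d :=
  ⟨U.1.submatrix id fun k => finProdFinEquiv.symm (Fin.castLE (Nat.le_mul_self d) k), by
    ext k l
    have h := congrFun (congrFun (Matrix.UnitaryGroup.star_mul_self U)
      (finProdFinEquiv.symm (Fin.castLE (Nat.le_mul_self d) k)))
      (finProdFinEquiv.symm (Fin.castLE (Nat.le_mul_self d) l))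
    refine Eq.trans h ?_
    simp only [Matrix.one_apply, finProdFinEquiv.symm.injective.eq_iff,
      (Fin.castLE_injective (Nat.le_mul_self d)).eq_iff]⟩

instance : CompactSpace (Matrix.unitaryGroup (Fin d × Fin d) ℂ) := by
  refine isCompact_iff_compactSpace.1 (show IsCompact (unitary (Matrix (Fin d × Fin d) (Fin d × Fin d) ℂ) :
    Set (Matrix (Fin d × Fin d) (Fin d × Fin d) ℂ)) from ?_)
  have h : IsCompact (Set.univ.pi fun _ => Set.univ.pi fun _ => Metric.closedBall 0 1 :
      Set (Matrix (Fin d × Fin d) (Fin d × Fin d) ℂ)) :=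
    isCompact_univ_pi fun _ => isCompact_univ_pi fun _ => isCompact_closedBall 0 1
  have hc : IsClosed (unitary (Matrix (Fin d × Fin d) (Fin d × Fin d) ℂ) :
      Set (Matrix (Fin d × Fin d) (Fin d × Fin d) ℂ)) :=
    isClosed_unitary (R := Matrix (Fin d × Fin d) (Fin d × Fin d) ℂ)
  refine h.of_isClosed_subset hc fun U hU i _ j _ => ?_
  simpa using entry_norm_bound_of_unitary hU i j

instance : MeasurableSpace (Matrix.unitaryGroup (Fin d × Fin d) ℂ) := borel _

instance : BorelSpace (Matrix.unitaryGroup (Fin d × Fin d) ℂ) := ⟨rfl⟩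

instance : MeasurableSpace (SpinIsometry d) := borel _

instance : BorelSpace (SpinIsometry d) := ⟨rfl⟩

/-- The Haar probability measure on the unitary group `U(d²)`. -/
def haarUnitary (d : ℕ) : Measure (Matrix.unitaryGroup (Fin d × Fin d) ℂ) :=
  Measure.haarMeasure ⊤

/-- The Haar measure on the isometries `V : ℂ^d → ℂ^d ⊗ ℂ^d`: the distribution of the first `d`
columns of a Haar random unitary matrix. -/
def haarIsometry (d : ℕ) : Measure (SpinIsometry d) :=
  (haarUnitary d).map firstColumns

lemma continuous_firstColumns :
    Continuous (firstColumns : Matrix.unitaryGroup (Fin d × Fin d) ℂ → SpinIsometry d) :=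
  Continuous.subtype_mk (continuous_subtype_val.matrix_submatrix _ _) _

instance : IsProbabilityMeasure (haarUnitary d) := ⟨Measure.haarMeasure_self⟩

instance : IsProbabilityMeasure (haarIsometry d) :=
  Measure.isProbabilityMeasure_map continuous_firstColumns.measurable.aemeasurable

end ThompsonTree

end

/-! Let `L = (V ⊗ 1) V` and `R = (1 ⊗ V) V` be the two isometries given by the binary trees with
three leaves, and let `Q = L† R`. With `l = 2⁻ⁿ`, let `f_n` be the element of `T` that maps `[0,
l/2]`, `[l/2, 3l/4]`, `[3l/4, l]` affinely onto `[0, l/4]`, `[l/4, l/2]`, `[l/2, l]` and fixes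
everything else. It moves no point by more than `l`, so `f_n → id` uniformly. But however small `l`
is, `f_n` turns a right-leaning tree on `[0, l]` into a left-leaning one. If the unit vector `Ψ` is
represented by `x` at level `n`, then `⟨Ψ, ρ(f_n) Ψ⟩ = ⟨x, (Q ⊗ 1) x⟩`, with `Q` acting on the
leftmost tensor factor. So it suffices that `|⟨v, Q v⟩| ≤ q ‖v‖²` for some `q < 1`: the bound does
not depend on `n`, and the matrix coefficients stay away from `⟨Ψ, Ψ⟩ = 1`
(`weaklyDiscontinuousAtId_of_overlapDefect`).

If no such `q` existed, compactness of the sphere would give equality in Cauchy–Schwarz for some `L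
v` and `R v`. Then `R v = r L v`, hence `Q v = r v`, `Q† v = r⁻¹ v` and `Q† Q v = v`. Thus `det (1 -
Q† Q) ≠ 0` is enough (`Matrix.exists_norm_inner_mulVec_le`).

This determinant is a polynomial in the entries of `V` and their conjugates, and it is not
identically zero: for `V e_k = e_a ⊗ e_{σ k}` with `σ a ≠ a` the images of `L` and `R` differ in the
middle factor, so `Q = 0`. Such a `σ` needs `d ≥ 2`; for `d = 1` always `Q = 1`.

It remains to see that the zero set is Haar null (`ae_haarUnitary_overlapDefect`). The Cayley
transform `C(x)` of a real-linear parametrization of the skew-Hermitian matrices is a real analytic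
family of unitaries. For each fixed `U`, the determinant at `C(x) U` is real analytic in `x` and
nonzero somewhere, hence nonzero for almost every `x`. By Fubini some single `x` works for almost
every `U`, and left invariance of Haar measure removes `C(x)`. -/

noncomputable section

namespace ThompsonTree

variable {d : ℕ}

/-! ### Three-leaf trees and their overlap -/

/-- The matrix of the left-leaning tree `(V ⊗ 1) V`. -/
def leftTree (V : Matrix (Fin d × Fin d) (Fin d) ℂ) :
    Matrix (Fin d × Fin d × Fin d) (Fin d) ℂ :=
  Matrix.of fun p k => ∑ m, V (m, p.2.2) k * V (p.1, p.2.1) m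

/-- The matrix of the right-leaning tree `(1 ⊗ V) V`. -/
def rightTree (V : Matrix (Fin d × Fin d) (Fin d) ℂ) :
    Matrix (Fin d × Fin d × Fin d) (Fin d) ℂ :=
  Matrix.of fun p k => ∑ m, V (p.1, m) k * V (p.2.1, p.2.2) m

/-- The overlap `((V ⊗ 1) V)† (1 ⊗ V) V` of the two trees with three leaves. -/
def overlap (V : Matrix (Fin d × Fin d) (Fin d) ℂ) : Matrix (Fin d) (Fin d) ℂ :=
  (leftTree V).conjTranspose * rightTree V

/-- The determinant of `1 - Q† Q`, where `Q` is the overlap. -/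
def overlapDefect (V : Matrix (Fin d × Fin d) (Fin d) ℂ) : ℂ :=
  (1 - (overlap V).conjTranspose * overlap V).det

/-- This is `⟨V x, V y⟩ = ⟨x, y⟩` in coordinates. It removes the inner vertex of a three-leaf tree,
after which `isometry_entry` removes the root. -/
lemma sum_mul_isometry (V : SpinIsometry d) (x y : Fin d → ℂ) :
    ∑ pq : Fin d × Fin d, star (∑ m, x m * V.1 pq m) * (∑ n, y n * V.1 pq n) =
      ∑ m, star (x m) * y m := by
  simp_rw [star_sum, star_mul', Finset.sum_mul_sum]
  rw [Finset.sum_comm]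
  refine Finset.sum_congr rfl fun m _ => ?_
  rw [Finset.sum_comm]
  have : ∀ n, ∑ pq : Fin d × Fin d, star (x m) * star (V.1 pq m) * (y n * V.1 pq n) =
      if m = n then star (x m) * y n else 0 := by
    intro n
    have h := isometry_entry V m n
    calc _ = star (x m) * y n * ∑ pq : Fin d × Fin d, star (V.1 pq m) * V.1 pq n := by
          rw [Finset.mul_sum]; exact Finset.sum_congr rfl fun _ _ => by ring
      _ = _ := by rw [h]; split_ifs <;> simp
  simp_rw [this]
  simp

lemma leftTree_isometry (V : SpinIsometry d) :
    (leftTree V.1).conjTranspose * leftTree V.1 = 1 := by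
  ext k l
  rw [Matrix.mul_apply, Matrix.one_apply, ← isometry_entry V k l]
  simp only [Matrix.conjTranspose_apply, leftTree, Matrix.of_apply]
  -- The inner vertex carries the first two legs, so the third leg has to become the outer summation
  -- index. For the right-leaning tree the order of summation is already the right one.
  have e : ∀ g : Fin d × Fin d × Fin d → ℂ,
      ∑ p, g p = ∑ r, ∑ pq : Fin d × Fin d, g (pq.1, pq.2, r) := by
    intro g
    simp_rw [Fintype.sum_prod_type]
    exact (Finset.sum_congr rfl fun _ _ => Finset.sum_comm).trans Finset.sum_comm
  rw [e]
  simp_rw [sum_mul_isometry V (fun m => V.1 (m, _) k) (fun m => V.1 (m, _) l)]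
  rw [Fintype.sum_prod_type, Finset.sum_comm]

lemma rightTree_isometry (V : SpinIsometry d) :
    (rightTree V.1).conjTranspose * rightTree V.1 = 1 := by
  ext k l
  rw [Matrix.mul_apply, Matrix.one_apply, ← isometry_entry V k l]
  simp only [Matrix.conjTranspose_apply, rightTree, Matrix.of_apply]
  rw [Fintype.sum_prod_type, Fintype.sum_prod_type]
  exact Finset.sum_congr rfl fun p _ =>
    sum_mul_isometry V (fun m => V.1 (p, m) k) (fun m => V.1 (p, m) l)

end ThompsonTree

/-! ### The angle between the images of two isometries -/

/-- Two isometries `L`, `R` for which `1 - Q† Q`, `Q = L† R`, is invertible have images with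
a positive angle. -/
lemma Matrix.exists_norm_inner_mulVec_le {m n : Type*} [Fintype m] [Fintype n] [DecidableEq n]
    {L R : Matrix m n ℂ} (hL : L.conjTranspose * L = 1) (hR : R.conjTranspose * R = 1)
    (h : (1 - (L.conjTranspose * R).conjTranspose * (L.conjTranspose * R)).det ≠ 0) :
    ∃ q < (1 : ℝ), 0 ≤ q ∧ ∀ v : n → ℂ,
      ‖star (L.mulVec v) ⬝ᵥ R.mulVec v‖ ≤ q * ∑ i, ‖v i‖ ^ 2 := by
  have hin : ∀ M : Matrix m n ℂ, M.conjTranspose * M = 1 → ∀ v : n → ℂ,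
      star (M.mulVec v) ⬝ᵥ M.mulVec v = star v ⬝ᵥ v := by
    intro M hM v
    rw [Matrix.star_mulVec, Matrix.dotProduct_mulVec, Matrix.vecMul_vecMul, hM, Matrix.vecMul_one]
  have hnorm : ∀ M : Matrix m n ℂ, M.conjTranspose * M = 1 → ∀ v : EuclideanSpace ℂ n,
      ‖(WithLp.toLp 2 (M.mulVec v.ofLp) : EuclideanSpace ℂ m)‖ = ‖v‖ := by
    intro M hM v
    have e := hin M hM v.ofLp
    rw [dotProduct_comm, dotProduct_comm (star v.ofLp)] at e
    have e2 : inner ℂ (WithLp.toLp 2 (M.mulVec v.ofLp) : EuclideanSpace ℂ m)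
      (WithLp.toLp 2 (M.mulVec v.ofLp)) = inner ℂ v v := e
    rw [inner_self_eq_norm_sq_to_K, inner_self_eq_norm_sq_to_K] at e2
    have e3 : ‖(WithLp.toLp 2 (M.mulVec v.ofLp) : EuclideanSpace ℂ m)‖ ^ 2 = ‖v‖ ^ 2 := by
      exact_mod_cast e2
    exact (sq_eq_sq₀ (norm_nonneg _) (norm_nonneg _)).1 e3
  let A : EuclideanSpace ℂ n → EuclideanSpace ℂ m := fun v => WithLp.toLp 2 (L.mulVec v.ofLp)
  let B : EuclideanSpace ℂ n → EuclideanSpace ℂ m := fun v => WithLp.toLp 2 (R.mulVec v.ofLp)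
  have hAB : ∀ v, inner ℂ (A v) (B v) = star (L.mulVec v.ofLp) ⬝ᵥ R.mulVec v.ofLp := fun v =>
    dotProduct_comm _ _
  have hA : ∀ v, ‖A v‖ = ‖v‖ := hnorm L hL
  have hB : ∀ v, ‖B v‖ = ‖v‖ := hnorm R hR
  have hcA : Continuous A := by fun_prop
  have hcB : Continuous B := by fun_prop
  have hsmul : ∀ (c : ℂ) (v : EuclideanSpace ℂ n),
      ‖inner ℂ (A (c • v)) (B (c • v))‖ = ‖c‖ ^ 2 * ‖inner ℂ (A v) (B v)‖ := by
    intro c v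
    have e1 : A (c • v) = c • A v := by
      simp only [A, WithLp.ofLp_smul, Matrix.mulVec_smul, WithLp.toLp_smul]
    have e2 : B (c • v) = c • B v := by
      simp only [B, WithLp.ofLp_smul, Matrix.mulVec_smul, WithLp.toLp_smul]
    rw [e1, e2, inner_smul_left, inner_smul_right, norm_mul, norm_mul, RCLike.norm_conj]
    ring
  have hsphere : ∃ q < (1 : ℝ), 0 ≤ q ∧
      ∀ v ∈ Metric.sphere (0 : EuclideanSpace ℂ n) 1, ‖inner ℂ (A v) (B v)‖ ≤ q := by
    -- The sphere is empty exactly when `n` is empty; otherwise `q` is the maximum over the sphere.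
    rcases (Metric.sphere (0 : EuclideanSpace ℂ n) 1).eq_empty_or_nonempty with he | hne
    · exact ⟨0, one_pos, le_rfl, by simp [he]⟩
    obtain ⟨v, hv, hmax⟩ := (isCompact_sphere (0 : EuclideanSpace ℂ n) 1).exists_isMaxOn hne
      (f := fun v => ‖inner ℂ (A v) (B v)‖) (by fun_prop)
    refine ⟨_, ?_, norm_nonneg _, fun w hw => hmax hw⟩
    have hv1 : ‖v‖ = 1 := by simpa using hv
    have hle : ‖inner ℂ (A v) (B v)‖ ≤ 1 := by
      simpa [hA, hB, hv1] using norm_inner_le_norm (𝕜 := ℂ) (A v) (B v)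
    -- A maximum equal to `1` is the equality case of Cauchy–Schwarz: `B v` is a multiple of `A v`,
    -- and `v` will lie in the kernel of `1 - Q† Q`.
    refine lt_of_le_of_ne hle fun heq => h ?_
    have hA0 : A v ≠ 0 := fun h0 => by have := hA v; rw [h0, hv1] at this; simp at this
    have hB0 : B v ≠ 0 := fun h0 => by have := hB v; rw [h0, hv1] at this; simp at this
    obtain ⟨r, hr, hrB⟩ : ∃ r : ℂ, r ≠ 0 ∧ B v = r • A v :=
      (norm_inner_eq_norm_iff hA0 hB0).1 (by rw [heq, hA, hB, hv1, one_mul])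
    have hRL : R.mulVec v.ofLp = r • L.mulVec v.ofLp := congrArg WithLp.ofLp hrB
    have hQ : (L.conjTranspose * R).mulVec v.ofLp = r • v.ofLp := by
      rw [← Matrix.mulVec_mulVec, hRL, Matrix.mulVec_smul, Matrix.mulVec_mulVec, hL,
        Matrix.one_mulVec]
    -- Reading the proportionality in the other direction yields the eigenvalue `r⁻¹` for `R† L`, so
    -- `|r| = 1` need not be known.
    have hQ' : (L.conjTranspose * R).conjTranspose.mulVec v.ofLp = r⁻¹ • v.ofLp := by
      have hLR : L.mulVec v.ofLp = r⁻¹ • R.mulVec v.ofLp := by rw [hRL, inv_smul_smul₀ hr]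
      rw [Matrix.conjTranspose_mul, Matrix.conjTranspose_conjTranspose, ← Matrix.mulVec_mulVec, hLR,
        Matrix.mulVec_smul, Matrix.mulVec_mulVec, hR, Matrix.one_mulVec]
    refine Matrix.exists_mulVec_eq_zero_iff.1 ⟨v.ofLp, fun h0 => ?_, ?_⟩
    · have : v = 0 := WithLp.ofLp_injective 2 h0
      simp [this] at hv1
    · rw [Matrix.sub_mulVec, Matrix.one_mulVec, ← Matrix.mulVec_mulVec, hQ, Matrix.mulVec_smul, hQ',
        smul_inv_smul₀ hr, sub_self]
  obtain ⟨q, hq1, hq0, hq⟩ := hsphere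
  refine ⟨q, hq1, hq0, fun x => ?_⟩
  set v : EuclideanSpace ℂ n := WithLp.toLp 2 x
  have hx : ∑ i, ‖x i‖ ^ 2 = ‖v‖ ^ 2 := (EuclideanSpace.norm_sq_eq v).symm
  rw [hx]
  change ‖star (L.mulVec v.ofLp) ⬝ᵥ R.mulVec v.ofLp‖ ≤ _
  rw [← hAB]
  by_cases h0 : v = 0
  · have : A v = 0 := by rw [← norm_eq_zero, hA, h0, norm_zero]
    rw [this, inner_zero_left, norm_zero]
    positivity
  have hn : ‖v‖ ≠ 0 := norm_ne_zero_iff.2 h0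
  -- Both sides are homogeneous of degree two, so the bound extends from the sphere by normalizing.
  have h1 := hq ((‖v‖⁻¹ : ℂ) • v) (by simp [norm_smul, hn])
  rw [hsmul] at h1
  have h2 : ‖(‖v‖⁻¹ : ℂ)‖ = ‖v‖⁻¹ := by simp
  rw [h2] at h1
  calc _ = ‖v‖ ^ 2 * (‖v‖⁻¹ ^ 2 * ‖inner ℂ (A v) (B v)‖) := by field_simp
    _ ≤ ‖v‖ ^ 2 * q := by gcongr
    _ = _ := mul_comm _ _

namespace ThompsonTree

variable {d : ℕ}

/-! ### Splitting one interval -/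

namespace DyadicPartition

lemma le_splitAt (K : DyadicPartition) (i : DyadicInterval) (hi : i ∈ K.parts) :
    K ≤ K.splitAt i hi := by
  refine le_iff.2 fun j hj => ?_
  rcases Finset.mem_insert.1 hj with rfl | hj
  · exact ⟨i, hi, i.fst_subset⟩
  rcases Finset.mem_insert.1 hj with rfl | hj
  · exact ⟨i, hi, i.snd_subset⟩
  · exact ⟨j, (Finset.mem_erase.1 hj).2, Subset.rfl⟩

lemma fst_mem_splitAt {K : DyadicPartition} {i : DyadicInterval} (hi : i ∈ K.parts) :
    i.fst ∈ (K.splitAt i hi).parts := Finset.mem_insert_self _ _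

lemma snd_mem_splitAt {K : DyadicPartition} {i : DyadicInterval} (hi : i ∈ K.parts) :
    i.snd ∈ (K.splitAt i hi).parts := Finset.mem_insert_of_mem (Finset.mem_insert_self _ _)

lemma mem_splitAt {K : DyadicPartition} {i j : DyadicInterval} (hi : i ∈ K.parts)
    (hj : j ∈ K.parts) (hji : j ≠ i) : j ∈ (K.splitAt i hi).parts :=
  Finset.mem_insert_of_mem (Finset.mem_insert_of_mem (Finset.mem_erase.2 ⟨hji, hj⟩))

lemma not_mem_splitAt {K : DyadicPartition} {i : DyadicInterval} (hi : i ∈ K.parts) :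
    i ∉ (K.splitAt i hi).parts := by
  intro h
  rcases Finset.mem_insert.1 h with h | h
  · simpa [DyadicInterval.fst] using congrArg DyadicInterval.level h
  rcases Finset.mem_insert.1 h with h | h
  · simpa [DyadicInterval.snd] using congrArg DyadicInterval.level h
  · exact (Finset.mem_erase.1 h).1 rfl

end DyadicPartition

open DyadicPartition

/-- The configuration of the intervals of `K` with value `k` at `i` that agrees with the
configuration `c` of the split partition elsewhere. -/
def mergeConfig {K : DyadicPartition} {i : DyadicInterval} (hi : i ∈ K.parts)
    (c : (K.splitAt i hi).parts → Fin d) (k : Fin d) : K.parts → Fin d :=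
  fun j => if h : j.1 = i then k else c ⟨j.1, mem_splitAt hi j.2 h⟩

/-- The forest from `K` to its split has one copy of `V`, at `i`, and trivial trees elsewhere. The
trivial trees contribute Kronecker deltas, which force the input configuration to agree with `c` off
`i` and leave only the sum over its value at `i`. -/
lemma refineLin_splitAt (V : SpinIsometry d) {K : DyadicPartition} {i : DyadicInterval}
    (hi : i ∈ K.parts) (x : SpinSpace d K) (c : (K.splitAt i hi).parts → Fin d) :
    refineLin V K (K.splitAt i hi) x c =
      ∑ k, V.1 (c ⟨i.fst, fst_mem_splitAt hi⟩, c ⟨i.snd, snd_mem_splitAt hi⟩) k *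
        x (mergeConfig hi c k) := by
  -- `contract` returns the default `0` at a non-leaf unless its level is below the depth; the leaf
  -- `i.fst` guarantees this for `i`.
  have hlev : i.level < depth (K.splitAt i hi).parts :=
    Nat.lt_of_succ_le (level_le_depth (fst_mem_splitAt hi))
  have hroot : ∀ k, contract V (K.splitAt i hi).parts (leafCovector c) i k =
      V.1 (c ⟨i.fst, fst_mem_splitAt hi⟩, c ⟨i.snd, snd_mem_splitAt hi⟩) k := by
    intro k
    rw [contract_split V _ (not_mem_splitAt hi) hlev, contract_mem V _ (fst_mem_splitAt hi),
      contract_mem V _ (snd_mem_splitAt hi), Fintype.sum_prod_type]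
    simp [leafCovector, fst_mem_splitAt hi, snd_mem_splitAt hi]
  have hleaf : ∀ (j : K.parts) (hj : j.1 ≠ i) (k : Fin d),
      contract V (K.splitAt i hi).parts (leafCovector c) j k =
        if c ⟨j.1, mem_splitAt hi j.2 hj⟩ = k then 1 else 0 := by
    intro j hj k
    rw [contract_mem V _ (mem_splitAt hi j.2 hj)]
    simp [leafCovector, mem_splitAt hi j.2 hj]
  have hself : ∀ k, mergeConfig hi c k ⟨i, hi⟩ = k := fun k => by simp [mergeConfig]
  rw [refineLin_apply]
  symm
  -- The sum over `k` is embedded in the sum over all configurations of `K`. A configuration outside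
  -- the image differs from `c` at some `j ≠ i`, and the delta there kills its term.
  refine Fintype.sum_of_injective (mergeConfig hi c) ?_ _ _ ?_ ?_
  · intro k l hkl
    rw [← hself k, hkl, hself]
  · intro a ha
    refine mul_eq_zero_of_left ?_ _
    by_contra hne
    refine ha ⟨a ⟨i, hi⟩, ?_⟩
    funext j
    rw [mergeConfig]
    split_ifs with hj
    · congr 1
      exact Subtype.ext hj.symm
    · have := Finset.prod_ne_zero_iff.1 hne j (Finset.mem_univ _)
      rw [hleaf j hj] at this
      by_contra hcj
      exact this (if_neg hcj)
  · intro k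
    congr 1
    rw [refineEntry, Finset.prod_eq_single ⟨i, hi⟩]
    · rw [hself, hroot]
    · intro j _ hj
      have hj' : j.1 ≠ i := fun h => hj (Subtype.ext h)
      rw [hleaf j hj', mergeConfig, dif_neg hj', if_pos rfl]
    · simp

/-! ### The overlap of two ways to split an interval into three -/

/-- Split `i` and then its left half. -/
abbrev splitLeft (K : DyadicPartition) {i : DyadicInterval} (hi : i ∈ K.parts) : DyadicPartition :=
  (K.splitAt i hi).splitAt i.fst (fst_mem_splitAt hi)

/-- Split `i` and then its right half. -/
abbrev splitRight (K : DyadicPartition) {i : DyadicInterval} (hi : i ∈ K.parts) : DyadicPartition :=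
  (K.splitAt i hi).splitAt i.snd (snd_mem_splitAt hi)

section

variable {K : DyadicPartition} {i : DyadicInterval}

lemma le_splitLeft (hi : i ∈ K.parts) : K ≤ splitLeft K hi := (le_splitAt _ _ _).trans (le_splitAt _ _ _)

lemma le_splitRight (hi : i ∈ K.parts) : K ≤ splitRight K hi := (le_splitAt _ _ _).trans (le_splitAt _ _ _)

/-- The intervals of `K` other than `i`. -/
abbrev Rest (K : DyadicPartition) (i : DyadicInterval) : Type :=
  {j : DyadicInterval // j ∈ K.parts ∧ j ≠ i}

instance (K : DyadicPartition) (i : DyadicInterval) : Fintype (Rest K i) :=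
  Fintype.ofInjective (fun j => (⟨j.1, j.2.1⟩ : K.parts)) fun _ _ h =>
    Subtype.ext (congrArg (fun j : K.parts => j.1) h)

lemma rest_ne_fst (hi : i ∈ K.parts) (j : Rest K i) : j.1 ≠ i.fst := fun h =>
  j.2.2 (K.eq_of_mem j.2.1 hi j.1.left_mem (i.fst_subset (h ▸ j.1.left_mem)))

lemma rest_ne_snd (hi : i ∈ K.parts) (j : Rest K i) : j.1 ≠ i.snd := fun h =>
  j.2.2 (K.eq_of_mem j.2.1 hi j.1.left_mem (i.snd_subset (h ▸ j.1.left_mem)))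

lemma rest_mem_splitLeft (hi : i ∈ K.parts) (j : Rest K i) : j.1 ∈ (splitLeft K hi).parts :=
  mem_splitAt _ (mem_splitAt hi j.2.1 j.2.2) (rest_ne_fst hi j)

lemma rest_mem_splitRight (hi : i ∈ K.parts) (j : Rest K i) : j.1 ∈ (splitRight K hi).parts :=
  mem_splitAt _ (mem_splitAt hi j.2.1 j.2.2) (rest_ne_snd hi j)

lemma fst_fst_mem (hi : i ∈ K.parts) : i.fst.fst ∈ (splitLeft K hi).parts := fst_mem_splitAt _

lemma fst_snd_mem (hi : i ∈ K.parts) : i.fst.snd ∈ (splitLeft K hi).parts := snd_mem_splitAt _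

lemma snd_mem (hi : i ∈ K.parts) : i.snd ∈ (splitLeft K hi).parts :=
  mem_splitAt _ (snd_mem_splitAt hi) i.fst_ne_snd.symm

lemma fst_mem (hi : i ∈ K.parts) : i.fst ∈ (splitRight K hi).parts :=
  mem_splitAt _ (fst_mem_splitAt hi) i.fst_ne_snd

lemma snd_fst_mem (hi : i ∈ K.parts) : i.snd.fst ∈ (splitRight K hi).parts := fst_mem_splitAt _

lemma snd_snd_mem (hi : i ∈ K.parts) : i.snd.snd ∈ (splitRight K hi).parts := snd_mem_splitAt _

/-- The configuration with value `k` at `i` and the values `r` elsewhere. -/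
def insertConfig (k : Fin d) (r : Rest K i → Fin d) : K.parts → Fin d :=
  fun j => if h : j.1 = i then k else r ⟨j.1, j.2, h⟩

/-- Configurations of `K` in terms of the value at `i` and the values elsewhere. -/
def configEquiv (hi : i ∈ K.parts) : (Fin d × (Rest K i → Fin d)) ≃ (K.parts → Fin d) where
  toFun p := insertConfig p.1 p.2
  invFun a := (a ⟨i, hi⟩, fun j => a ⟨j.1, j.2.1⟩)
  left_inv p := by
    refine Prod.ext (by simp [insertConfig]) (funext fun j => ?_)
    simp [insertConfig, j.2.2]
  right_inv a := by
    funext j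
    simp only [insertConfig]
    split_ifs with h
    · congr 1
      exact Subtype.ext h.symm
    · rfl

lemma mem_splitLeft_cases (hi : i ∈ K.parts) {j : DyadicInterval} (h : j ∈ (splitLeft K hi).parts) :
    j = i.fst.fst ∨ j = i.fst.snd ∨ j = i.snd ∨ (j ∈ K.parts ∧ j ≠ i) := by
  simp only [splitLeft, splitAt, Finset.mem_insert, Finset.mem_erase] at h
  tauto

/-- Configurations of `splitLeft K hi` in terms of the values at the parts of `i` and the values
elsewhere. -/
def splitLeftConfigEquiv (hi : i ∈ K.parts) :
    ((splitLeft K hi).parts → Fin d) ≃ ((Fin d × Fin d × Fin d) × (Rest K i → Fin d)) where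
  toFun c := ((c ⟨_, fst_fst_mem hi⟩, c ⟨_, fst_snd_mem hi⟩, c ⟨_, snd_mem hi⟩),
    fun j => c ⟨j.1, rest_mem_splitLeft hi j⟩)
  invFun p j := if h1 : j.1 = i.fst.fst then p.1.1 else if h2 : j.1 = i.fst.snd then p.1.2.1 else
    if h3 : j.1 = i.snd then p.1.2.2 else
      p.2 ⟨j.1, (((mem_splitLeft_cases hi j.2).resolve_left h1).resolve_left h2).resolve_left h3⟩
  left_inv c := by
    funext j
    dsimp only
    split_ifs with h1 h2 h3
    · congr 1; exact Subtype.ext h1.symm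
    · congr 1; exact Subtype.ext h2.symm
    · congr 1; exact Subtype.ext h3.symm
    · rfl
  right_inv p := by
    -- The quarters of `i` have a level above that of `i.snd`, and they are disjoint from the other
    -- intervals of `K`, so the cases of `invFun` do not collide.
    have hl : i.snd ≠ i.fst.fst := fun h => by
      simpa [DyadicInterval.fst, DyadicInterval.snd] using congrArg DyadicInterval.level h
    have hl' : i.snd ≠ i.fst.snd := fun h => by
      simpa [DyadicInterval.fst, DyadicInterval.snd] using congrArg DyadicInterval.level h
    have hr : ∀ j : Rest K i, j.1 ≠ i.fst.fst := fun j h =>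
      j.2.2 (K.eq_of_mem j.2.1 hi j.1.left_mem
        (i.fst_subset (i.fst.fst_subset (h ▸ j.1.left_mem))))
    have hr' : ∀ j : Rest K i, j.1 ≠ i.fst.snd := fun j h =>
      j.2.2 (K.eq_of_mem j.2.1 hi j.1.left_mem
        (i.fst_subset (i.fst.snd_subset (h ▸ j.1.left_mem))))
    refine Prod.ext (Prod.ext ?_ (Prod.ext ?_ ?_)) (funext fun j => ?_)
    · simp
    · simp [i.fst.fst_ne_snd.symm]
    · simp [hl, hl']
    · simp [hr j, hr' j, rest_ne_snd hi j]

/-- Two applications of `refineLin_splitAt`, at `i` and then at `i.fst`, produce `(V ⊗ 1) V` on the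
factor of `i`. The values `r` on the other intervals are spectators, so the refinement acts slice by
slice. -/
lemma refineLin_splitLeft (hi : i ∈ K.parts) (V : SpinIsometry d) (x : SpinSpace d K)
    (p : Fin d × Fin d × Fin d) (r : Rest K i → Fin d) :
    refineLin V K (splitLeft K hi) x ((splitLeftConfigEquiv hi).symm (p, r)) =
      (leftTree V.1).mulVec (fun k => x (insertConfig k r)) p := by
  obtain ⟨c, hc⟩ := (splitLeftConfigEquiv hi).surjective (p, r)
  rw [← hc, Equiv.symm_apply_apply]
  simp only [splitLeftConfigEquiv, Equiv.coe_fn_mk, Prod.mk.injEq] at hc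
  obtain ⟨rfl, rfl⟩ := hc
  rw [← refineLin_trans V (le_splitAt K i hi) (K := splitLeft K hi) (le_splitAt _ _ _)]
  refine (refineLin_splitAt V (fst_mem_splitAt hi) _ _).trans ?_
  simp_rw [refineLin_splitAt, Matrix.mulVec, dotProduct, leftTree, Matrix.of_apply, Finset.mul_sum,
    Finset.sum_mul]
  rw [Finset.sum_comm]
  refine Finset.sum_congr rfl fun k _ => Finset.sum_congr rfl fun m _ => ?_
  have e1 : mergeConfig (fst_mem_splitAt hi) c m ⟨i.fst, fst_mem_splitAt hi⟩ = m := by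
    simp [mergeConfig]
  have e2 : mergeConfig (fst_mem_splitAt hi) c m ⟨i.snd, snd_mem_splitAt hi⟩ =
      c ⟨_, snd_mem hi⟩ := by
    simp [mergeConfig, i.fst_ne_snd.symm]
  -- Undoing both splits forgets the summation index `m` together with the values of `c` on the
  -- parts of `i`.
  have e3 : mergeConfig hi (mergeConfig (fst_mem_splitAt hi) c m) k =
      insertConfig k (fun j => c ⟨j.1, rest_mem_splitLeft hi j⟩) := by
    funext j
    rw [mergeConfig, insertConfig]
    split_ifs with h
    · rfl
    · exact dif_neg (rest_ne_fst hi ⟨j.1, j.2, h⟩)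
  rw [e1, e2, e3]
  ring

/-- The mirror image of `refineLin_splitLeft`. It is stated for a bare configuration `c` because it
is evaluated at a configuration pulled back from `splitLeft K hi` by the relabelling. -/
lemma refineLin_splitRight (hi : i ∈ K.parts) (V : SpinIsometry d) (x : SpinSpace d K)
    (c : (splitRight K hi).parts → Fin d) :
    refineLin V K (splitRight K hi) x c =
      (rightTree V.1).mulVec
        (fun k => x (insertConfig k fun j => c ⟨j.1, rest_mem_splitRight hi j⟩))
        (c ⟨_, fst_mem hi⟩, c ⟨_, snd_fst_mem hi⟩, c ⟨_, snd_snd_mem hi⟩) := by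
  rw [← refineLin_trans V (le_splitAt K i hi) (K := splitRight K hi) (le_splitAt _ _ _)]
  refine (refineLin_splitAt V (snd_mem_splitAt hi) _ _).trans ?_
  simp_rw [refineLin_splitAt, Matrix.mulVec, dotProduct, rightTree, Matrix.of_apply, Finset.mul_sum,
    Finset.sum_mul]
  rw [Finset.sum_comm]
  refine Finset.sum_congr rfl fun k _ => Finset.sum_congr rfl fun m _ => ?_
  have e1 : mergeConfig (snd_mem_splitAt hi) c m ⟨i.snd, snd_mem_splitAt hi⟩ = m := by
    simp [mergeConfig]
  have e2 : mergeConfig (snd_mem_splitAt hi) c m ⟨i.fst, fst_mem_splitAt hi⟩ =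
      c ⟨_, fst_mem hi⟩ := by
    simp [mergeConfig, i.fst_ne_snd]
  have e3 : mergeConfig hi (mergeConfig (snd_mem_splitAt hi) c m) k =
      insertConfig k (fun j => c ⟨j.1, rest_mem_splitRight hi j⟩) := by
    funext j
    rw [mergeConfig, insertConfig]
    split_ifs with h
    · rfl
    · exact dif_neg (rest_ne_snd hi ⟨j.1, j.2, h⟩)
  rw [e1, e2, e3]
  ring

/-- The hypotheses on `e` match the three leaves of the two trees from left to right and fix the
rest. Since only the factor of `i` is touched, the inner product is the sum over `r` of `⟨L x_r, R
x_r⟩` for the slices `x_r` of `x`. The bound for one slice then sums to the squared norm, with the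
same `q` for every `K`. -/
lemma norm_inner_refine_relabel_le (hi : i ∈ K.parts) (V : SpinIsometry d) {q : ℝ}
    (hq : ∀ v : Fin d → ℂ, ‖star ((leftTree V.1).mulVec v) ⬝ᵥ (rightTree V.1).mulVec v‖ ≤
      q * ∑ k, ‖v k‖ ^ 2)
    (e : (splitRight K hi).parts ≃ (splitLeft K hi).parts)
    (h1 : e ⟨_, fst_mem hi⟩ = ⟨_, fst_fst_mem hi⟩)
    (h2 : e ⟨_, snd_fst_mem hi⟩ = ⟨_, fst_snd_mem hi⟩)
    (h3 : e ⟨_, snd_snd_mem hi⟩ = ⟨_, snd_mem hi⟩)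
    (h4 : ∀ j : Rest K i, e ⟨j.1, rest_mem_splitRight hi j⟩ = ⟨j.1, rest_mem_splitLeft hi j⟩)
    (x : SpinSpace d K) :
    ‖inner ℂ (refineLin V K (splitLeft K hi) x) (relabel e (refineLin V K (splitRight K hi) x))‖ ≤
      q * ‖x‖ ^ 2 := by
  have hL : ∀ (p : Fin d × Fin d × Fin d) (r : Rest K i → Fin d),
      relabel e (refineLin V K (splitRight K hi) x) ((splitLeftConfigEquiv hi).symm (p, r)) =
        (rightTree V.1).mulVec (fun k => x (insertConfig k r)) p := by
    intro p r
    obtain ⟨c, hc⟩ := (splitLeftConfigEquiv hi).surjective (p, r)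
    rw [← hc, Equiv.symm_apply_apply]
    simp only [splitLeftConfigEquiv, Equiv.coe_fn_mk, Prod.mk.injEq] at hc
    obtain ⟨rfl, rfl⟩ := hc
    rw [relabel_apply, refineLin_splitRight]
    simp only [Function.comp_apply, h1, h2, h3, h4]
  have hsum : inner ℂ (refineLin V K (splitLeft K hi) x)
      (relabel e (refineLin V K (splitRight K hi) x)) =
      ∑ r : Rest K i → Fin d, star ((leftTree V.1).mulVec (fun k => x (insertConfig k r))) ⬝ᵥ
        (rightTree V.1).mulVec (fun k => x (insertConfig k r)) := by
    -- Configurations are sorted by their values off `i`; the inner sum over the three leaves of `i`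
    -- is then a dot product of two tree vectors.
    rw [PiLp.inner_apply, ← Equiv.sum_comp (splitLeftConfigEquiv hi).symm, Fintype.sum_prod_type,
      Finset.sum_comm]
    refine Finset.sum_congr rfl fun r _ => Finset.sum_congr rfl fun p _ => ?_
    rw [hL, refineLin_splitLeft]
    exact mul_comm _ _
  rw [hsum, EuclideanSpace.norm_sq_eq, ← Equiv.sum_comp (configEquiv hi), Fintype.sum_prod_type,
    Finset.sum_comm, Finset.mul_sum]
  exact (norm_sum_le _ _).trans (Finset.sum_le_sum fun r _ => hq _)

end

end ThompsonTree

namespace ThompsonTree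

/-! ### Thompson's generator on a short interval -/

/-- The piecewise linear map of `[0, l]` with slopes `1/2`, `1`, `2`, extended by the identity. -/
def squeeze (l x : ℝ) : ℝ := min x (max (x / 2) (max (x - l / 4) (2 * x - l)))

/-- The inverse of `squeeze l`. -/
def unsqueeze (l y : ℝ) : ℝ := max y (min (2 * y) (min (y + l / 4) ((y + l) / 2)))

section

variable {l x y : ℝ}

lemma squeeze_of_le_half (hx : 0 ≤ x) (h : x ≤ l / 2) : squeeze l x = x / 2 := by
  rw [squeeze, max_eq_left (max_le (by linarith) (by linarith)), min_eq_right (by linarith)]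

lemma squeeze_of_mid (h1 : l / 2 ≤ x) (h2 : x ≤ 3 * l / 4) (_hl : 0 ≤ l) :
    squeeze l x = x - l / 4 := by
  rw [squeeze, max_eq_left (by linarith : 2 * x - l ≤ x - l / 4), max_eq_right (by linarith),
    min_eq_right (by linarith)]

lemma squeeze_of_ge (h1 : 3 * l / 4 ≤ x) (h2 : x ≤ l) (_hl : 0 ≤ l) :
    squeeze l x = 2 * x - l := by
  rw [squeeze, max_eq_right (by linarith : x - l / 4 ≤ 2 * x - l), max_eq_right (by linarith),
    min_eq_right (by linarith)]

lemma squeeze_of_le (h : l ≤ x) : squeeze l x = x :=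
  min_eq_left (le_max_of_le_right (le_max_of_le_right (by linarith)))

/-- For the preservation of dyadic points it does not matter which branch applies where, only that
every branch preserves them. -/
lemma squeeze_cases (l x : ℝ) : squeeze l x = x ∨ squeeze l x = x / 2 ∨
    squeeze l x = x - l / 4 ∨ squeeze l x = 2 * x - l := by
  unfold squeeze
  rcases min_choice x (max (x / 2) (max (x - l / 4) (2 * x - l))) with h | h <;> rw [h]
  · simp
  rcases max_choice (x / 2) (max (x - l / 4) (2 * x - l)) with h | h <;> rw [h]
  · simp
  rcases max_choice (x - l / 4) (2 * x - l) with h | h <;> rw [h] <;> simp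

/-- The breakpoints `l/2`, `3l/4`, `l` go to `l/4`, `l/2`, `l`. On `[0, l]` the map is the maximum
of its three affine branches (it is convex there) and its inverse is the minimum of the inverse
branches; the outer `min` and `max` select the identity beyond `l`. -/
lemma unsqueeze_squeeze (hl : 0 ≤ l) (hx : 0 ≤ x) : unsqueeze l (squeeze l x) = x := by
  rcases le_total x (l / 2) with h1 | h1
  · rw [squeeze_of_le_half hx h1, unsqueeze, min_eq_left (le_min (by linarith) (by linarith)),
      max_eq_right (by linarith)]
    ring
  rcases le_total x (3 * l / 4) with h2 | h2
  · rw [squeeze_of_mid h1 h2 hl, unsqueeze,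
      min_eq_left (by linarith : x - l / 4 + l / 4 ≤ (x - l / 4 + l) / 2),
      min_eq_right (by linarith), max_eq_right (by linarith)]
    ring
  rcases le_total x l with h3 | h3
  · rw [squeeze_of_ge h2 h3 hl, unsqueeze,
      min_eq_right (by linarith : (2 * x - l + l) / 2 ≤ 2 * x - l + l / 4),
      min_eq_right (by linarith), max_eq_right (by linarith)]
    ring
  · rw [squeeze_of_le h3, unsqueeze, max_eq_left]
    exact (min_le_right _ _).trans ((min_le_right _ _).trans (by linarith))

lemma squeeze_unsqueeze (hl : 0 ≤ l) (hy : 0 ≤ y) : squeeze l (unsqueeze l y) = y := by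
  rcases le_total y (l / 4) with h1 | h1
  · have e : unsqueeze l y = 2 * y := by
      rw [unsqueeze, min_eq_left (le_min (by linarith) (by linarith)), max_eq_right (by linarith)]
    rw [e, squeeze_of_le_half (by linarith) (by linarith)]
    ring
  rcases le_total y (l / 2) with h2 | h2
  · have e : unsqueeze l y = y + l / 4 := by
      rw [unsqueeze, min_eq_left (by linarith : y + l / 4 ≤ (y + l) / 2),
        min_eq_right (by linarith), max_eq_right (by linarith)]
    rw [e, squeeze_of_mid (by linarith) (by linarith) hl]
    ring
  rcases le_total y l with h3 | h3
  · have e : unsqueeze l y = (y + l) / 2 := by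
      rw [unsqueeze, min_eq_right (by linarith : (y + l) / 2 ≤ y + l / 4),
        min_eq_right (by linarith), max_eq_right (by linarith)]
    rw [e, squeeze_of_ge (by linarith) (by linarith) hl]
    ring
  · have e : unsqueeze l y = y :=
      max_eq_left ((min_le_right _ _).trans ((min_le_right _ _).trans (by linarith)))
    rw [e, squeeze_of_le h3]

/-- A crude bound; any bound that tends to `0` with `l` serves. -/
lemma abs_squeeze_sub_le (hl : 0 ≤ l) (hx : 0 ≤ x) : |squeeze l x - x| ≤ l := by
  rw [abs_le]
  rcases le_total x (l / 2) with h1 | h1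
  · rw [squeeze_of_le_half hx h1]; constructor <;> linarith
  rcases le_total x (3 * l / 4) with h2 | h2
  · rw [squeeze_of_mid h1 h2 hl]; constructor <;> linarith
  rcases le_total x l with h3 | h3
  · rw [squeeze_of_ge h2 h3 hl]; constructor <;> linarith
  · rw [squeeze_of_le h3]; constructor <;> linarith

lemma squeeze_mem (hx : x ∈ Ico (0 : ℝ) 1) : squeeze l x ∈ Ico (0 : ℝ) 1 := by
  refine ⟨le_min hx.1 (le_max_of_le_left ?_), (min_le_left _ _).trans_lt hx.2⟩
  have := hx.1
  positivity

lemma unsqueeze_mem (hy : y ∈ Ico (0 : ℝ) 1) (hl : l ≤ 1) :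
    unsqueeze l y ∈ Ico (0 : ℝ) 1 := by
  refine ⟨le_max_of_le_left hy.1, max_lt hy.2 ?_⟩
  exact ((min_le_right _ _).trans (min_le_right _ _)).trans_lt (by linarith [hy.2])

lemma exists_coe_mem_Ico (z : UnitAddCircle) : ∃ x ∈ Ico (0 : ℝ) 1, (x : UnitAddCircle) = z := by
  have := AddCircle.coe_image_Ico_eq (1 : ℝ) 0
  rw [zero_add] at this
  have hz : z ∈ (QuotientAddGroup.mk '' Ico (0 : ℝ) 1 : Set UnitAddCircle) := this ▸ mem_univ z
  exact hz

/-! ### Passage from the interval to the circle and membership in the Thompson group -/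

/-- The homeomorphism of the circle that is induced by mutually inverse continuous maps of `[0, 1]`
fixing the endpoints. -/
def circleHomeo (g h : ℝ → ℝ) (hg : Continuous g) (hh : Continuous h)
    (g0 : g 0 = 0) (g1 : g 1 = 1) (h0 : h 0 = 0) (h1 : h 1 = 1)
    (hgm : ∀ x ∈ Ico (0 : ℝ) 1, g x ∈ Ico (0 : ℝ) 1) (hhm : ∀ x ∈ Ico (0 : ℝ) 1, h x ∈ Ico (0 : ℝ) 1)
    (hgh : ∀ x ∈ Ico (0 : ℝ) 1, h (g x) = x) (hhg : ∀ x ∈ Ico (0 : ℝ) 1, g (h x) = x) :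
    UnitAddCircle ≃ₜ UnitAddCircle where
  toFun := AddCircle.liftIco 1 0 fun x => (g x : UnitAddCircle)
  invFun := AddCircle.liftIco 1 0 fun x => (h x : UnitAddCircle)
  left_inv z := by
    obtain ⟨x, hx, rfl⟩ := exists_coe_mem_Ico z
    rw [AddCircle.liftIco_zero_coe_apply hx, AddCircle.liftIco_zero_coe_apply (hgm x hx), hgh x hx]
  right_inv z := by
    obtain ⟨x, hx, rfl⟩ := exists_coe_mem_Ico z
    rw [AddCircle.liftIco_zero_coe_apply hx, AddCircle.liftIco_zero_coe_apply (hhm x hx), hhg x hx]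
  continuous_toFun := AddCircle.liftIco_zero_continuous
    (by rw [g0, g1]; exact (AddCircle.coe_period (1 : ℝ)).symm)
    ((AddCircle.continuous_mk' 1).comp hg).continuousOn
  continuous_invFun := AddCircle.liftIco_zero_continuous
    (by rw [h0, h1]; exact (AddCircle.coe_period (1 : ℝ)).symm)
    ((AddCircle.continuous_mk' 1).comp hh).continuousOn

lemma hasSlopeAt_of_eqOn {f : UnitAddCircle → UnitAddCircle} {a b c : ℝ} {k : ℤ}
    (hf : ∀ y ∈ Ioo a b, f (y : UnitAddCircle) = ((2 ^ k * y + c : ℝ) : UnitAddCircle))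
    (hx : x ∈ Ioo a b) : HasSlopeAt f k (x : UnitAddCircle) := by
  have ht : Tendsto (fun v : ℝ => x + v) (𝓝 0) (𝓝 x) := by
    have : Continuous fun v : ℝ => x + v := by fun_prop
    simpa using this.tendsto 0
  filter_upwards [ht.eventually (Ioo_mem_nhds hx.1 hx.2)] with v hv
  rw [← AddCircle.coe_add, hf _ hv, hf x hx, ← AddCircle.coe_add]
  congr 1
  ring

end

/-- The homeomorphism of the circle that is induced by `squeeze (1 / 2 ^ n)`. -/
def squeezeHomeo (n : ℕ) : UnitAddCircle ≃ₜ UnitAddCircle :=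
  have hl : (0 : ℝ) ≤ 1 / 2 ^ n := by positivity
  have hl1 : (1 : ℝ) / 2 ^ n ≤ 1 := by
    rw [div_le_one (by positivity)]
    exact one_le_pow₀ (by norm_num)
  circleHomeo (squeeze (1 / 2 ^ n)) (unsqueeze (1 / 2 ^ n))
    (by unfold squeeze; fun_prop) (by unfold unsqueeze; fun_prop)
    (by rw [squeeze_of_le_half le_rfl (by positivity), zero_div]) (squeeze_of_le hl1)
    -- The endpoint values of the inverse follow from those of `squeeze` by the inverse identity.
    (by
      conv_rhs => rw [← unsqueeze_squeeze hl le_rfl]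
      rw [squeeze_of_le_half le_rfl (by positivity), zero_div])
    (by
      conv_rhs => rw [← unsqueeze_squeeze hl zero_le_one]
      rw [squeeze_of_le hl1])
    (fun _ hx => squeeze_mem hx) (fun _ hx => unsqueeze_mem hx hl1)
    (fun _ hx => unsqueeze_squeeze hl hx.1) (fun _ hx => squeeze_unsqueeze hl hx.1)

lemma squeezeHomeo_coe (n : ℕ) {x : ℝ} (hx : x ∈ Ico (0 : ℝ) 1) :
    squeezeHomeo n (x : UnitAddCircle) = (squeeze (1 / 2 ^ n) x : UnitAddCircle) :=
  AddCircle.liftIco_zero_coe_apply (f := fun x => (squeeze (1 / 2 ^ n) x : UnitAddCircle)) hx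

lemma isDyadic_coe (p : ℤ) (n : ℕ) : IsDyadic ((p / 2 ^ n : ℝ) : UnitAddCircle) := ⟨p, n, rfl⟩

lemma squeezeHomeo_mem (n : ℕ) : squeezeHomeo n ∈ ThompsonT := by
  classical
  have hl : (0 : ℝ) < 1 / 2 ^ n := by positivity
  have hl1 : (1 : ℝ) / 2 ^ n ≤ 1 := by
    rw [div_le_one (by positivity)]
    exact one_le_pow₀ (by norm_num)
  have d1 : IsDyadic ((1 / 2 ^ n : ℝ) : UnitAddCircle) := by simpa using isDyadic_coe 1 n
  have d2 : IsDyadic ((1 / 2 ^ n / 2 : ℝ) : UnitAddCircle) := by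
    convert isDyadic_coe 1 (n + 1) using 2; push_cast; rw [pow_succ]; field_simp
  have d3 : IsDyadic ((3 * (1 / 2 ^ n) / 4 : ℝ) : UnitAddCircle) := by
    convert isDyadic_coe 3 (n + 2) using 2; push_cast; rw [pow_add]; field_simp; norm_num
  have d4 : IsDyadic ((1 / 2 ^ n / 4 : ℝ) : UnitAddCircle) := by
    convert isDyadic_coe 1 (n + 2) using 2; push_cast; rw [pow_add]; field_simp; norm_num
  have d0 : IsDyadic ((0 : ℝ) : UnitAddCircle) := by
    convert isDyadic_coe 0 0 using 2; simp
  -- The base point is a breakpoint too: the slope to its right is `1/2`, and to its left, across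
  -- the gluing, it is `1` (or `2` when `n = 0`).
  refine ⟨fun z hz => ?_, {((0 : ℝ) : UnitAddCircle), ((1 / 2 ^ n / 2 : ℝ) : UnitAddCircle),
    ((3 * (1 / 2 ^ n) / 4 : ℝ) : UnitAddCircle), ((1 / 2 ^ n : ℝ) : UnitAddCircle)}, ?_, ?_⟩
  · obtain ⟨x, hx, rfl⟩ := exists_coe_mem_Ico z
    rw [squeezeHomeo_coe n hx]
    obtain ⟨p, m, hpm⟩ := hz.exists_real
    rcases squeeze_cases (1 / 2 ^ n) x with h | h | h | h <;> rw [h]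
    · exact hz
    · convert isDyadic_zpow (-1) p m using 2
      rw [hpm, zpow_neg_one]; ring
    · rw [AddCircle.coe_sub]
      exact isDyadic_sub hz d4
    · rw [AddCircle.coe_sub]
      refine isDyadic_sub ?_ d1
      convert isDyadic_zpow 1 p m using 2
      rw [hpm, zpow_one]
  · intro b hb
    simp only [Finset.mem_insert, Finset.mem_singleton] at hb
    rcases hb with rfl | rfl | rfl | rfl <;> assumption
  · intro z hz
    obtain ⟨x, hx, rfl⟩ := exists_coe_mem_Ico z
    simp only [Finset.mem_insert, Finset.mem_singleton, not_or] at hz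
    obtain ⟨z0, z1, z2, z3⟩ := hz
    have n0 : 0 < x := lt_of_le_of_ne hx.1 fun h => z0 (by rw [h])
    have n1 : x ≠ 1 / 2 ^ n / 2 := fun h => z1 (by rw [h])
    have n2 : x ≠ 3 * (1 / 2 ^ n) / 4 := fun h => z2 (by rw [h])
    have n3 : x ≠ 1 / 2 ^ n := fun h => z3 (by rw [h])
    generalize hlen : (1 : ℝ) / 2 ^ n = l at *
    rcases lt_or_gt_of_ne n1 with h1 | h1
    · refine ⟨-1, hasSlopeAt_of_eqOn (a := 0) (b := l / 2) (c := 0) (fun y hy => ?_) ⟨n0, h1⟩⟩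
      rw [squeezeHomeo_coe n ⟨hy.1.le, by linarith [hy.2]⟩, hlen,
        squeeze_of_le_half hy.1.le hy.2.le, zpow_neg_one]
      congr 1; ring
    rcases lt_or_gt_of_ne n2 with h2 | h2
    · refine ⟨0, hasSlopeAt_of_eqOn (a := l / 2) (b := 3 * l / 4) (c := -(l / 4)) (fun y hy => ?_)
        ⟨h1, h2⟩⟩
      rw [squeezeHomeo_coe n ⟨by linarith [hy.1], by linarith [hy.2]⟩, hlen,
        squeeze_of_mid hy.1.le hy.2.le hl.le, zpow_zero]
      congr 1; ring
    rcases lt_or_gt_of_ne n3 with h3 | h3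
    · refine ⟨1, hasSlopeAt_of_eqOn (a := 3 * l / 4) (b := l) (c := -l) (fun y hy => ?_)
        ⟨h2, h3⟩⟩
      rw [squeezeHomeo_coe n ⟨by linarith [hy.1], by linarith [hy.2]⟩, hlen,
        squeeze_of_ge hy.1.le hy.2.le hl.le, zpow_one]
      congr 1
    · refine ⟨0, hasSlopeAt_of_eqOn (a := l) (b := 1) (c := 0) (fun y hy => ?_) ⟨h3, hx.2⟩⟩
      rw [squeezeHomeo_coe n ⟨by linarith [hy.1], by linarith [hy.2]⟩, hlen,
        squeeze_of_le hy.1.le, zpow_zero]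
      congr 1; ring

/-- `squeezeHomeo n` as an element of the Thompson group. -/
def squeezeT (n : ℕ) : ThompsonT := ⟨squeezeHomeo n, squeezeHomeo_mem n⟩

lemma supDistId_squeezeT_le (n : ℕ) : supDistId (squeezeT n) ≤ 1 / 2 ^ n := by
  refine ciSup_le fun z => ?_
  obtain ⟨x, hx, rfl⟩ := exists_coe_mem_Ico z
  change ‖squeezeHomeo n x - x‖ ≤ _
  rw [squeezeHomeo_coe n hx, ← AddCircle.coe_sub]
  -- The circle distance is at most the distance of representatives.
  refine (QuotientAddGroup.norm_mk_le_norm).trans ?_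
  rw [Real.norm_eq_abs]
  exact abs_squeeze_sub_le (by positivity) hx.1

lemma tendsto_supDistId_squeezeT : Tendsto (fun n => supDistId (squeezeT n)) atTop (𝓝 0) := by
  refine squeeze_zero (fun n => Real.iSup_nonneg fun _ => norm_nonneg _) supDistId_squeezeT_le ?_
  simpa [one_div_pow] using
    tendsto_pow_atTop_nhds_zero_of_lt_one (r := (1 / 2 : ℝ)) (by norm_num) (by norm_num)

/-! ### The generator carries the right-leaning subdivision to the left-leaning one -/

/-- The leftmost interval of level `n`. -/
def leftmost (n : ℕ) : DyadicInterval := ⟨n, 0, by positivity⟩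

lemma leftmost_mem (n : ℕ) : leftmost n ∈ (DyadicPartition.uniform n).parts :=
  DyadicPartition.mem_uniform.2 rfl

lemma leftmost_left (n : ℕ) : (leftmost n).left = 0 := by simp [leftmost, DyadicInterval.left]

lemma leftmost_len (n : ℕ) : (leftmost n).len = 1 / 2 ^ n := rfl

/-- Replacing the parameter `t` by `(x - i.left) / i.len` reduces the claim on the circle to an
identity of real functions, which each branch of `squeeze` satisfies by direct computation. -/
lemma mapsAffinely_squeeze {n : ℕ} {i j : DyadicInterval}
    (h : ∀ x ∈ i.toSet, squeeze (1 / 2 ^ n) x = j.left + (x - i.left) / i.len * j.len) :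
    MapsAffinely (squeezeHomeo n) i j := fun t ht => by
  have hx := i.param_mem ht
  rw [squeezeHomeo_coe n (i.toSet_subset hx), h _ hx]
  congr 2
  have := i.len_pos
  field_simp
  ring

lemma mapsAffinely_squeeze_fst (n : ℕ) :
    MapsAffinely (squeezeHomeo n) (leftmost n).fst (leftmost n).fst.fst := by
  have hl : (0 : ℝ) < 1 / 2 ^ n := by positivity
  refine mapsAffinely_squeeze fun x hx => ?_
  simp only [DyadicInterval.toSet, DyadicInterval.fst_left, DyadicInterval.fst_len,
    leftmost_left, leftmost_len] at hx ⊢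
  generalize (1 : ℝ) / 2 ^ n = l at *
  rw [squeeze_of_le_half hx.1 (by linarith [hx.2])]
  field_simp
  ring

lemma mapsAffinely_squeeze_snd_fst (n : ℕ) :
    MapsAffinely (squeezeHomeo n) (leftmost n).snd.fst (leftmost n).fst.snd := by
  have hl : (0 : ℝ) < 1 / 2 ^ n := by positivity
  refine mapsAffinely_squeeze fun x hx => ?_
  simp only [DyadicInterval.toSet, DyadicInterval.fst_left, DyadicInterval.fst_len,
    DyadicInterval.snd_left, DyadicInterval.snd_len, leftmost_left, leftmost_len] at hx ⊢
  generalize (1 : ℝ) / 2 ^ n = l at *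
  rw [squeeze_of_mid (by linarith [hx.1]) (by linarith [hx.2]) hl.le]
  field_simp
  ring

lemma mapsAffinely_squeeze_snd_snd (n : ℕ) :
    MapsAffinely (squeezeHomeo n) (leftmost n).snd.snd (leftmost n).snd := by
  have hl : (0 : ℝ) < 1 / 2 ^ n := by positivity
  refine mapsAffinely_squeeze fun x hx => ?_
  simp only [DyadicInterval.toSet, DyadicInterval.snd_left, DyadicInterval.snd_len, leftmost_left,
    leftmost_len] at hx ⊢
  generalize (1 : ℝ) / 2 ^ n = l at *
  rw [squeeze_of_ge (by linarith [hx.1]) (by linarith [hx.2]) hl.le]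
  field_simp
  ring

/-- A level `n` interval other than the leftmost one has index at least `1`, so it lies to the right
of `1 / 2 ^ n`, where `squeeze` is the identity. -/
lemma mapsAffinely_squeeze_of_ne {n : ℕ} {j : DyadicInterval} (hj : j.level = n)
    (hne : j ≠ leftmost n) : MapsAffinely (squeezeHomeo n) j j := by
  refine mapsAffinely_squeeze fun x hx => ?_
  have hidx : (1 : ℝ) ≤ j.idx := by
    have : j.idx ≠ 0 := fun h => hne (DyadicInterval.ext hj h)
    exact_mod_cast Nat.one_le_iff_ne_zero.2 this
  have hleft : 1 / 2 ^ n ≤ j.left := by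
    rw [DyadicInterval.left, hj]
    gcongr
  rw [squeeze_of_le (hleft.trans hx.1)]
  have := j.len_pos
  field_simp
  ring

lemma carries_squeeze (n : ℕ) :
    ∃ e : (splitRight _ (leftmost_mem n)).parts ≃ (splitLeft _ (leftmost_mem n)).parts,
      Carries (squeezeHomeo n) _ _ e := by
  have key : ∀ j ∈ (splitRight _ (leftmost_mem n)).parts,
      ∃ j' ∈ (splitLeft _ (leftmost_mem n)).parts, MapsAffinely (squeezeHomeo n) j j' := by
    intro j hj
    have hj' : j = (leftmost n).fst ∨ j = (leftmost n).snd.fst ∨ j = (leftmost n).snd.snd ∨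
        (j ∈ (DyadicPartition.uniform n).parts ∧ j ≠ leftmost n) := by
      simp only [splitRight, DyadicPartition.splitAt, Finset.mem_insert, Finset.mem_erase] at hj
      tauto
    rcases hj' with rfl | rfl | rfl | h
    · exact ⟨_, fst_fst_mem _, mapsAffinely_squeeze_fst n⟩
    · exact ⟨_, fst_snd_mem _, mapsAffinely_squeeze_snd_fst n⟩
    · exact ⟨_, snd_mem _, mapsAffinely_squeeze_snd_snd n⟩
    · exact ⟨_, rest_mem_splitLeft (leftmost_mem n) ⟨j, h⟩,
        mapsAffinely_squeeze_of_ne (DyadicPartition.mem_uniform.1 h.1) h.2⟩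
  obtain ⟨J, e, he⟩ := carries_of_forall (f := squeezeHomeo n)
    (I := splitRight _ (leftmost_mem n)) fun j hj => by
      obtain ⟨j', -, h⟩ := key j hj
      exact ⟨j', h⟩
  -- `carries_of_forall` gives an unspecified target partition. Its parts all belong to the
  -- left-leaning subdivision, and a partition contained in another one equals it.
  obtain rfl : J = splitLeft _ (leftmost_mem n) := by
    refine DyadicPartition.ext_of_subset fun j hj => ?_
    obtain ⟨i, hi⟩ := e.surjective ⟨j, hj⟩
    obtain ⟨j', hj', h⟩ := key i i.2
    have h2 := he i
    rw [hi] at h2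
    have h3 : j = j' := h2.unique h
    exact h3 ▸ hj'
  exact ⟨e, he⟩

/-- The same `Ψ` can be represented at every level `n`, and the generator supported on the leftmost
interval of that level sees only one copy of the overlap `Q`. The coefficients are therefore bounded
by one `q < 1` for all `n`, whereas convergence would force the limit `1`. -/
theorem weaklyDiscontinuousAtId_of_overlapDefect {d : ℕ} (hd : 0 < d) (V : SpinIsometry d)
    (h : overlapDefect V.1 ≠ 0) : WeaklyDiscontinuousAtId V := by
  obtain ⟨q, hq1, -, hq⟩ := Matrix.exists_norm_inner_mulVec_le (leftTree_isometry V)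
    (rightTree_isometry V) h
  -- A unit vector on the undivided interval, which every uniform partition refines, so that no
  -- initial `n` has to be excluded.
  let I := DyadicPartition.uniform 0
  let x : SpinSpace d I := EuclideanSpace.single (fun _ => ⟨0, hd⟩) 1
  have hx : ‖x‖ = 1 := by simp [x]
  let Ψ : SemicontinuousLimit V := (PreLimit.mk V I x : PreLimit V)
  have hΨ : inner ℂ Ψ Ψ = 1 := by
    rw [UniformSpace.Completion.inner_coe, PreLimit.inner_mk, inner_self_eq_norm_sq_to_K, hx]
    simp
  refine ⟨squeezeT, tendsto_supDistId_squeezeT, Ψ, Ψ, fun hlim => ?_⟩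
  have hbound : ∀ n, ‖inner ℂ Ψ (rho V (squeezeT n) Ψ)‖ ≤ q := by
    intro n
    obtain ⟨e, he⟩ := carries_squeeze n
    have hIK : I ≤ DyadicPartition.uniform n := DyadicPartition.le_uniform fun i hi => by
      rw [DyadicPartition.mem_uniform.1 hi]; exact Nat.zero_le n
    -- `Ψ` is represented in two ways: on the right-leaning subdivision, where the generator acts by
    -- relabelling, and on the left-leaning one, where the result lives.
    have hR : PreLimit.mk V I x = PreLimit.mk V _ (refineLin V _ (splitRight _ (leftmost_mem n))
        (refineLin V I (DyadicPartition.uniform n) x)) := by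
      rw [PreLimit.mk_refine V (le_splitRight _), PreLimit.mk_refine V hIK]
    have hL : PreLimit.mk V I x = PreLimit.mk V _ (refineLin V _ (splitLeft _ (leftmost_mem n))
        (refineLin V I (DyadicPartition.uniform n) x)) := by
      rw [PreLimit.mk_refine V (le_splitLeft _), PreLimit.mk_refine V hIK]
    have hact : rho V (squeezeT n) Ψ = (PreLimit.mk V _ (relabel e (refineLin V _ _
        (refineLin V I (DyadicPartition.uniform n) x))) : PreLimit V) := by
      simp only [Ψ]
      rw [hR]
      exact rho_mk V (squeezeT n) he _
    rw [hact]
    simp only [Ψ]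
    rw [hL, UniformSpace.Completion.inner_coe, PreLimit.inner_mk]
    refine (norm_inner_refine_relabel_le (leftmost_mem n) V hq e ?_ ?_ ?_ ?_ _).trans ?_
    · exact Subtype.ext ((he _).unique (mapsAffinely_squeeze_fst n))
    · exact Subtype.ext ((he _).unique (mapsAffinely_squeeze_snd_fst n))
    · exact Subtype.ext ((he _).unique (mapsAffinely_squeeze_snd_snd n))
    · exact fun j => Subtype.ext ((he _).unique
        (mapsAffinely_squeeze_of_ne (DyadicPartition.mem_uniform.1 j.2.1) j.2.2))
    · have : ‖refineLin V I (DyadicPartition.uniform n) x‖ = 1 := by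
        rw [← refine_apply V hIK, LinearIsometry.norm_map, hx]
      rw [this, one_pow, mul_one]
  have := le_of_tendsto hlim.norm (Eventually.of_forall hbound)
  rw [hΨ, norm_one] at this
  linarith

end ThompsonTree

/-! ### Zero sets of real analytic functions -/

/-- By the identity theorem on the connected line, the nonvanishing set is codiscrete, and
codiscrete subsets of the line have full measure. -/
lemma AnalyticOnNhd.ae_ne_zero_real {f : ℝ → ℂ} (hf : AnalyticOnNhd ℝ f univ) {a : ℝ}
    (ha : f a ≠ 0) : ∀ᵐ y, f y ≠ 0 := by
  have := ae_restrict_le_codiscreteWithin (μ := (volume : Measure ℝ)) MeasurableSet.univ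
    (hf.preimage_zero_mem_codiscrete ha)
  rwa [Measure.restrict_univ] at this

/-- Induction on the number of variables with Fubini, splitting off the first coordinate; continuity
of `f` supplies measurability. -/
lemma AnalyticOnNhd.ae_ne_zero {m : ℕ} {f : (Fin m → ℝ) → ℂ} (hf : AnalyticOnNhd ℝ f univ)
    {x : Fin m → ℝ} (hx : f x ≠ 0) : ∀ᵐ y, f y ≠ 0 := by
  induction m with
  | zero => exact Eventually.of_forall fun y => Subsingleton.elim x y ▸ hx
  | succ m ih =>
    let e := MeasurableEquiv.piFinSuccAbove (fun _ : Fin (m + 1) => ℝ) 0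
    have he : MeasurePreserving e.symm := (volume_preserving_piFinSuccAbove (fun _ => ℝ) 0).symm
    have hes : ∀ p, e.symm p = Fin.cons p.1 p.2 := fun p => by
      simp [e, MeasurableEquiv.piFinSuccAbove, Fin.insertNthEquiv]
    have hcf : Continuous f := continuousOn_univ.1 hf.continuousOn
    rw [← he.map_eq, ae_map_iff he.measurable.aemeasurable
      (isOpen_ne_fun hcf continuous_const).measurableSet]
    have hcons : ∀ p : ℝ × (Fin m → ℝ), AnalyticAt ℝ
        (fun p : ℝ × (Fin m → ℝ) => (Fin.cons p.1 p.2 : Fin (m + 1) → ℝ)) p := by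
      intro p
      refine AnalyticAt.pi fun i => ?_
      refine Fin.cases ?_ (fun i => ?_) i
      · exact analyticAt_fst
      · exact ((ContinuousLinearMap.proj (R := ℝ) (φ := fun _ : Fin m => ℝ) i).comp
          (ContinuousLinearMap.snd ℝ ℝ (Fin m → ℝ))).analyticAt p
    have hF : ∀ p : ℝ × (Fin m → ℝ),
        AnalyticAt ℝ (fun p : ℝ × (Fin m → ℝ) => f (Fin.cons p.1 p.2)) p := fun p =>
      (hf _ (mem_univ _)).comp (hcons p)
    have hx' : f (Fin.cons (x 0) (Fin.tail x)) ≠ 0 := by rwa [Fin.cons_self_tail]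
    -- Along the line through `x` in the first coordinate direction `f` is almost everywhere
    -- nonzero. For each such `a` the point `Fin.tail x` witnesses that the slice at `a` is not
    -- identically zero, as the induction hypothesis requires.
    have h1 : ∀ᵐ a : ℝ, f (Fin.cons a (Fin.tail x)) ≠ 0 :=
      AnalyticOnNhd.ae_ne_zero_real
        (f := fun a => f (Fin.cons a (Fin.tail x))) (fun a _ => (hF (a, Fin.tail x)).comp
          (f := fun a => (a, Fin.tail x)) (analyticAt_id.prod analyticAt_const)) hx'
    have hm : MeasurableSet {p : ℝ × (Fin m → ℝ) | f (e.symm p) ≠ 0} :=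
      e.symm.measurable (isOpen_ne_fun hcf continuous_const).measurableSet
    rw [Measure.volume_eq_prod, Measure.ae_prod_iff_ae_ae hm]
    filter_upwards [h1] with a ha
    simp_rw [hes]
    exact ih (f := fun y => f (Fin.cons a y)) (fun y _ => (hF (a, y)).comp
          (f := fun y => (a, y)) (analyticAt_const.prod analyticAt_id)) ha

/-! ### The Cayley transform -/

namespace Matrix

variable {n : Type*} [Fintype n] [DecidableEq n]

/-- The Cayley transform. -/
def cayley (S : Matrix n n ℂ) : Matrix n n ℂ := (1 + S) * (1 - S)⁻¹

open scoped ComplexOrder in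
-- A skew-Hermitian matrix has no eigenvalue `1`: if `S v = v`, moving `S` across the inner product
-- gives `⟨v, v⟩ = -⟨v, v⟩`.
lemma isUnit_one_sub_of_skew {S : Matrix n n ℂ} (hS : S.conjTranspose = -S) :
    IsUnit (1 - S) := by
  rw [Matrix.isUnit_iff_isUnit_det, isUnit_iff_ne_zero]
  intro h
  obtain ⟨v, hv, h0⟩ := Matrix.exists_mulVec_eq_zero_iff.2 h
  rw [Matrix.sub_mulVec, Matrix.one_mulVec, sub_eq_zero] at h0
  have h1 : star v ⬝ᵥ v = -(star v ⬝ᵥ v) := by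
    calc star v ⬝ᵥ v = star (S *ᵥ v) ⬝ᵥ v := by rw [← h0]
      _ = -(star v ⬝ᵥ (S *ᵥ v)) := by
        rw [Matrix.star_mulVec, hS, Matrix.vecMul_neg, neg_dotProduct, Matrix.dotProduct_mulVec]
      _ = _ := by rw [← h0]
  have h2 : star v ⬝ᵥ v = 0 := self_eq_neg.1 h1
  exact hv (dotProduct_star_self_eq_zero.1 h2)

lemma isUnit_one_add_of_skew {S : Matrix n n ℂ} (hS : S.conjTranspose = -S) :
    IsUnit (1 + S) := by
  rw [← sub_neg_eq_add]
  exact isUnit_one_sub_of_skew (by rw [Matrix.conjTranspose_neg, hS])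

/-- Taking the adjoint exchanges `1 + S` and `1 - S`, and these two commute. -/
lemma cayley_mem_unitaryGroup {S : Matrix n n ℂ} (hS : S.conjTranspose = -S) :
    cayley S ∈ unitaryGroup n ℂ := by
  have h1 := (Matrix.isUnit_iff_isUnit_det _).1 (isUnit_one_sub_of_skew hS)
  have h2 := (Matrix.isUnit_iff_isUnit_det _).1 (isUnit_one_add_of_skew hS)
  rw [mem_unitaryGroup_iff', star_eq_conjTranspose, cayley, conjTranspose_mul,
    conjTranspose_nonsing_inv, conjTranspose_sub, conjTranspose_add, conjTranspose_one, hS,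
    sub_neg_eq_add, ← sub_eq_add_neg]
  have hc : (1 - S) * (1 + S) = (1 + S) * (1 - S) := by noncomm_ring
  calc (1 + S)⁻¹ * (1 - S) * ((1 + S) * (1 - S)⁻¹)
      = (1 + S)⁻¹ * ((1 - S) * (1 + S)) * (1 - S)⁻¹ := by simp only [Matrix.mul_assoc]
    _ = ((1 + S)⁻¹ * (1 + S)) * ((1 - S) * (1 - S)⁻¹) := by
        rw [hc]; simp only [Matrix.mul_assoc]
    _ = 1 := by rw [Matrix.nonsing_inv_mul _ h2, Matrix.mul_nonsing_inv _ h1, one_mul]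

/-- The transform is inverted by `S = (w - 1) (w + 1)⁻¹`, which is skew-Hermitian because `w† w =
1`. Then `1 - S = 2 (w + 1)⁻¹` and `1 + S = 2 w (w + 1)⁻¹`. -/
lemma exists_cayley_eq {w : Matrix n n ℂ} (hw : w ∈ unitaryGroup n ℂ) (h : IsUnit (w + 1)) :
    ∃ S : Matrix n n ℂ, S.conjTranspose = -S ∧ cayley S = w := by
  have hd := (Matrix.isUnit_iff_isUnit_det _).1 h
  have hd' : IsUnit (w.conjTranspose + 1).det := by
    have : w.conjTranspose + 1 = (w + 1).conjTranspose := by simp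
    rw [this, det_conjTranspose]
    exact hd.star
  have hww : w.conjTranspose * w = 1 := mem_unitaryGroup_iff'.1 hw
  refine ⟨(w - 1) * (w + 1)⁻¹, ?_, ?_⟩
  · rw [conjTranspose_mul, conjTranspose_nonsing_inv, conjTranspose_sub, conjTranspose_add,
      conjTranspose_one]
    have e : (w.conjTranspose - 1) * (w + 1) = -((w.conjTranspose + 1) * (w - 1)) := by
      simp only [Matrix.sub_mul, Matrix.add_mul, Matrix.mul_add, Matrix.mul_sub, hww, one_mul,
        mul_one]
      abel
    calc (w.conjTranspose + 1)⁻¹ * (w.conjTranspose - 1)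
        = (w.conjTranspose + 1)⁻¹ * ((w.conjTranspose - 1) * (w + 1)) * (w + 1)⁻¹ := by
          rw [Matrix.mul_assoc, Matrix.mul_assoc, Matrix.mul_nonsing_inv _ hd, mul_one]
      _ = -((w.conjTranspose + 1)⁻¹ * (w.conjTranspose + 1) * ((w - 1) * (w + 1)⁻¹)) := by
          rw [e]; simp only [Matrix.mul_neg, Matrix.neg_mul, Matrix.mul_assoc]
      _ = _ := by rw [Matrix.nonsing_inv_mul _ hd', one_mul]
  · have e1 : 1 - (w - 1) * (w + 1)⁻¹ = (2 : ℂ) • (w + 1)⁻¹ := by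
      calc 1 - (w - 1) * (w + 1)⁻¹ = (w + 1) * (w + 1)⁻¹ - (w - 1) * (w + 1)⁻¹ := by
            rw [Matrix.mul_nonsing_inv _ hd]
        _ = _ := by
            rw [← Matrix.sub_mul, two_smul, ← Matrix.one_mul (w + 1)⁻¹, ← Matrix.add_mul,
              ← Matrix.mul_assoc]
            congr 1
            rw [mul_one]
            abel
    have e2 : 1 + (w - 1) * (w + 1)⁻¹ = (2 : ℂ) • (w * (w + 1)⁻¹) := by
      calc 1 + (w - 1) * (w + 1)⁻¹ = (w + 1) * (w + 1)⁻¹ + (w - 1) * (w + 1)⁻¹ := by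
            rw [Matrix.mul_nonsing_inv _ hd]
        _ = _ := by rw [two_smul]; noncomm_ring
    have e3 : ((2 : ℂ) • (w + 1)⁻¹)⁻¹ = (2 : ℂ)⁻¹ • (w + 1) := by
      refine Matrix.inv_eq_right_inv ?_
      rw [Matrix.smul_mul, Matrix.mul_smul, smul_smul, Matrix.nonsing_inv_mul _ hd]
      norm_num
    rw [cayley, e1, e2, e3, Matrix.smul_mul, Matrix.mul_smul, smul_smul, Matrix.mul_assoc,
      Matrix.nonsing_inv_mul _ hd]
    norm_num

/-- The Cayley transform misses the unitaries with eigenvalue `-1`; a phase avoids this. The circle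
is infinite and the spectrum finite, so some `z` of modulus one is not an eigenvalue, and `c = -z⁻¹`
gives `c w + 1 = z⁻¹ (z - w)`. -/
lemma exists_smul_add_one_isUnit (w : Matrix n n ℂ) :
    ∃ c : ℂ, ‖c‖ = 1 ∧ IsUnit (c • w + 1) := by
  have hinf : (Metric.sphere (0 : ℂ) 1).Infinite := by
    refine (isPreconnected_sphere (by simp) 0 1).infinite_of_nontrivial
      ⟨1, by simp, -1, by simp, by norm_num⟩
  obtain ⟨z, hz, hzs⟩ := (hinf.sdiff w.finite_spectrum).nonempty
  have hz1 : ‖z‖ = 1 := by simpa using hz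
  have hz0 : z ≠ 0 := fun h => by simp [h] at hz1
  refine ⟨-z⁻¹, by simp [hz1], ?_⟩
  rw [spectrum.notMem_iff] at hzs
  have e : -z⁻¹ • w + 1 = z⁻¹ • (algebraMap ℂ (Matrix n n ℂ) z - w) := by
    rw [smul_sub, Algebra.algebraMap_eq_smul_one, smul_smul, inv_mul_cancel₀ hz0, one_smul,
      neg_smul]
    abel
  rw [e]
  exact (IsUnit.smul (Units.mk0 z⁻¹ (inv_ne_zero hz0)) hzs :)

/-! ### Analyticity of the Cayley transform and real coordinates on skew-Hermitian matrices -/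

section Analytic

open scoped Matrix.Norms.Operator

lemma analyticAt_cayley {E : Type*} [NormedAddCommGroup E] [NormedSpace ℝ E]
    (T : E →L[ℝ] Matrix n n ℂ) {x : E} (hx : IsUnit (1 - T x)) :
    AnalyticAt ℝ (fun x => cayley (T x)) x := by
  have h1 : AnalyticAt ℝ (fun x => 1 - T x) x := analyticAt_const.sub (T.analyticAt x)
  have h2 : AnalyticAt ℝ (Ring.inverse : Matrix n n ℂ → Matrix n n ℂ) (1 - T x) :=
    analyticAt_inverse hx.unit
  have h3 : AnalyticAt ℝ (fun x => (1 - T x)⁻¹) x := by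
    simp_rw [Matrix.nonsing_inv_eq_ringInverse]
    exact AnalyticAt.comp (f := fun x => 1 - T x) h2 h1
  exact (analyticAt_const.add (T.analyticAt x)).mul h3

lemma analyticAt_cayley_apply {E : Type*} [NormedAddCommGroup E] [NormedSpace ℝ E]
    (T : E →L[ℝ] Matrix n n ℂ) {x : E} (hx : IsUnit (1 - T x)) (i j : n) :
    AnalyticAt ℝ (fun x => cayley (T x) i j) x :=
  ((LinearMap.toContinuousLinearMap (Matrix.entryLinearMap ℝ ℂ i j)).analyticAt _).comp
    (analyticAt_cayley T hx)

end Analytic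

/-- The map `X ↦ X - X†` has skew-Hermitian values and sends `S / 2` to `S` if `S` is
skew-Hermitian. The coordinates are redundant, which is harmless: only surjectivity and Lebesgue
measure on the parameters are used. -/
lemma exists_skew_parametrization (n : Type*) [Fintype n] [DecidableEq n] :
    ∃ (m : ℕ) (T : (Fin m → ℝ) →L[ℝ] Matrix n n ℂ), (∀ x, (T x).conjTranspose = -T x) ∧
      ∀ S : Matrix n n ℂ, S.conjTranspose = -S → ∃ x, T x = S := by
  let e := (Module.finBasis ℝ (Matrix n n ℂ)).equivFun.symm
  let A : Matrix n n ℂ →ₗ[ℝ] Matrix n n ℂ :=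
    { toFun := fun X => X - X.conjTranspose
      map_add' := fun X Y => by rw [conjTranspose_add]; abel
      map_smul' := fun r X => by
        rw [RingHom.id_apply, smul_sub, conjTranspose_smul, star_trivial] }
  refine ⟨_, (LinearMap.toContinuousLinearMap (A ∘ₗ e.toLinearMap)), fun x => ?_, fun S hS => ?_⟩
  · simp [A]
  · refine ⟨e.symm ((1 / 2 : ℝ) • S), ?_⟩
    simp only [A, LinearMap.coe_toContinuousLinearMap', LinearMap.coe_comp, Function.comp_apply,
      LinearEquiv.coe_coe, LinearEquiv.apply_symm_apply, LinearMap.coe_mk, AddHom.coe_mk,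
      conjTranspose_smul, star_trivial, hS]
    rw [smul_neg, sub_neg_eq_add, ← add_smul]
    norm_num

end Matrix

namespace ThompsonTree

variable {d : ℕ}

/-! ### The overlap defect does not vanish almost surely -/

section

variable {E : Type*} [NormedAddCommGroup E] [NormedSpace ℝ E]

/-- Conjugation is only real-linear, and the overlap contains conjugates; this is why analyticity is
taken over `ℝ`. -/
lemma _root_.AnalyticAt.complex_star {f : E → ℂ} {x : E} (hf : AnalyticAt ℝ f x) :
    AnalyticAt ℝ (fun x => star (f x)) x :=
  (Complex.conjCLE.toContinuousLinearMap.analyticAt _).comp hf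

lemma _root_.AnalyticAt.matrix_det {n : Type*} [Fintype n] [DecidableEq n]
    {M : E → Matrix n n ℂ} {x : E} (hM : ∀ i j, AnalyticAt ℝ (fun x => M x i j) x) :
    AnalyticAt ℝ (fun x => (M x).det) x := by
  simp_rw [Matrix.det_apply']
  exact Finset.analyticAt_fun_sum _ fun σ _ =>
    analyticAt_const.mul (Finset.analyticAt_fun_prod _ fun i _ => hM _ _)

lemma analyticAt_overlapDefect {W : E → Matrix (Fin d × Fin d) (Fin d) ℂ} {x : E}
    (hW : ∀ p k, AnalyticAt ℝ (fun x => W x p k) x) :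
    AnalyticAt ℝ (fun x => overlapDefect (W x)) x := by
  have hL : ∀ p k, AnalyticAt ℝ (fun x => leftTree (W x) p k) x := by
    intro p k
    simp only [leftTree, Matrix.of_apply]
    exact Finset.analyticAt_fun_sum _ fun m _ => (hW _ _).fun_mul (hW _ _)
  have hR : ∀ p k, AnalyticAt ℝ (fun x => rightTree (W x) p k) x := by
    intro p k
    simp only [rightTree, Matrix.of_apply]
    exact Finset.analyticAt_fun_sum _ fun m _ => (hW _ _).fun_mul (hW _ _)
  have hQ : ∀ l k, AnalyticAt ℝ (fun x => overlap (W x) l k) x := by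
    intro l k
    simp only [overlap, Matrix.mul_apply, Matrix.conjTranspose_apply]
    exact Finset.analyticAt_fun_sum _ fun p _ => (hL p l).complex_star.fun_mul (hR p k)
  refine AnalyticAt.matrix_det fun k l => ?_
  simp only [Matrix.sub_apply, Matrix.mul_apply, Matrix.conjTranspose_apply]
  exact analyticAt_const.fun_sub (Finset.analyticAt_fun_sum _ fun p _ =>
    (hQ p k).complex_star.fun_mul (hQ p l))

end

lemma continuous_overlapDefect :
    Continuous (overlapDefect : Matrix (Fin d × Fin d) (Fin d) ℂ → ℂ) := by
  have hL : Continuous (leftTree : Matrix (Fin d × Fin d) (Fin d) ℂ → _) :=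
    continuous_matrix fun p k => by simp only [leftTree, Matrix.of_apply]; fun_prop
  have hR : Continuous (rightTree : Matrix (Fin d × Fin d) (Fin d) ℂ → _) :=
    continuous_matrix fun p k => by simp only [rightTree, Matrix.of_apply]; fun_prop
  have hQ : Continuous (overlap : Matrix (Fin d × Fin d) (Fin d) ℂ → _) :=
    hL.matrix_conjTranspose.matrix_mul hR
  exact (continuous_const.sub (hQ.matrix_conjTranspose.matrix_mul hQ)).matrix_det

/-! ### An explicit isometry with zero overlap -/

/-- The overlap vanishes if `V e_k` is a multiple of `e_a ⊗ e_{σ k}` and `σ a ≠ a`. -/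
lemma overlapDefect_eq_one {V : Matrix (Fin d × Fin d) (Fin d) ℂ} {a : Fin d} {σ : Fin d → Fin d}
    (ha : σ a ≠ a) (hV : ∀ p q k, V (p, q) k ≠ 0 → p = a ∧ q = σ k) : overlapDefect V = 1 := by
  have hQ : overlap V = 0 := by
    ext l k
    rw [overlap, Matrix.mul_apply]
    refine Finset.sum_eq_zero fun ⟨p, q, r⟩ _ => ?_
    -- The middle leg separates the trees: the left-leaning one is supported where it equals `σ a`,
    -- the right-leaning one where it equals `a`.
    by_cases hq : q = a
    · refine mul_eq_zero_of_left ?_ _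
      rw [Matrix.conjTranspose_apply, star_eq_zero, leftTree, Matrix.of_apply]
      refine Finset.sum_eq_zero fun m _ => ?_
      by_contra hne
      have h1 := (hV _ _ _ (left_ne_zero_of_mul hne)).1
      have h2 := (hV _ _ _ (right_ne_zero_of_mul hne)).2
      dsimp only at h1 h2
      rw [h1, hq] at h2
      exact ha h2.symm
    · refine mul_eq_zero_of_right _ ?_
      rw [rightTree, Matrix.of_apply]
      refine Finset.sum_eq_zero fun m _ => ?_
      by_contra hne
      exact hq (hV _ _ _ (right_ne_zero_of_mul hne)).1
  rw [overlapDefect, hQ, Matrix.mul_zero, sub_zero, Matrix.det_one]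

/-- The witness is the permutation matrix that swaps two basis vectors in the second tensor factor.
The scalar `c` is needed because the Cayley transform reaches a given unitary only up to a phase;
multiples preserve the support condition of `overlapDefect_eq_one`. -/
lemma exists_overlapDefect_ne_zero (hd : 2 ≤ d) :
    ∃ u ∈ Matrix.unitaryGroup (Fin d × Fin d) ℂ, ∀ c : ℂ,
      overlapDefect ((c • u).submatrix id
        fun k => finProdFinEquiv.symm (Fin.castLE (Nat.le_mul_self d) k)) ≠ 0 := by
  let a : Fin d := ⟨0, by omega⟩
  let b : Fin d := ⟨1, by omega⟩
  have hab : b ≠ a := fun h => by simpa [a, b] using congrArg Fin.val h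
  let σ : Equiv.Perm (Fin d) := Equiv.swap a b
  let τ : Equiv.Perm (Fin d × Fin d) := Equiv.prodCongr (Equiv.refl _) σ
  refine ⟨τ.permMatrix ℂ, ?_, fun c => ?_⟩
  · rw [Matrix.mem_unitaryGroup_iff', Matrix.star_eq_conjTranspose,
      Matrix.conjTranspose_permMatrix, ← Matrix.permMatrix_mul, mul_inv_cancel,
      Matrix.permMatrix_one]
  · rw [overlapDefect_eq_one (a := a) (σ := σ) (by simpa [σ] using hab)]
    · exact one_ne_zero
    · intro p q k h
      -- In the lexicographic order the first `d` columns are those indexed by `e_a ⊗ e_k`, where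
      -- `a` is the first basis index.
      have hcol : finProdFinEquiv.symm (Fin.castLE (Nat.le_mul_self d) k) = (a, k) := by
        rw [Equiv.symm_apply_eq]
        exact Fin.ext (by simp [finProdFinEquiv, a])
      rw [Matrix.submatrix_apply, hcol, Matrix.smul_apply] at h
      have h1 := right_ne_zero_of_smul h
      rw [Equiv.Perm.permMatrix, PEquiv.toMatrix_toPEquiv_apply] at h1
      have h2 : τ (p, q) = (a, k) := by
        by_contra hne
        exact h1 (Pi.single_eq_of_ne (Ne.symm hne) 1)
      simp only [τ, Equiv.prodCongr_apply, Prod.map_apply, Equiv.refl_apply, Prod.mk.injEq] at h2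
      refine ⟨h2.1, ?_⟩
      rw [← h2.2]
      simp [σ]

/-! ### From Lebesgue measure on the parameters to Haar measure -/

instance : Measure.IsMulLeftInvariant (haarUnitary d) :=
  inferInstanceAs (Measure.IsMulLeftInvariant (Measure.haarMeasure ⊤))

/-- Haar measure is never written in coordinates. The double statement over `(x, U)` holds for
almost every `x` at each `U` by analyticity; exchanging the quantifiers and using left invariance at
one good `x` leaves the statement about `U` alone. -/
lemma ae_haarUnitary_overlapDefect (hd : 2 ≤ d) :
    ∀ᵐ U ∂haarUnitary d, overlapDefect (firstColumns U).1 ≠ 0 := by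
  obtain ⟨m, T, hT, hTs⟩ := Matrix.exists_skew_parametrization (Fin d × Fin d)
  obtain ⟨u, hu, hu0⟩ := exists_overlapDefect_ne_zero hd
  let C : (Fin m → ℝ) → Matrix.unitaryGroup (Fin d × Fin d) ℂ := fun x =>
    ⟨Matrix.cayley (T x), Matrix.cayley_mem_unitaryGroup (hT x)⟩
  have hCan : ∀ x i j, AnalyticAt ℝ (fun x => (C x).1 i j) x := fun x i j =>
    Matrix.analyticAt_cayley_apply T (Matrix.isUnit_one_sub_of_skew (hT x)) i j
  have hC : Continuous C := Continuous.subtype_mk (continuous_matrix fun i j =>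
    continuous_iff_continuousAt.2 fun x => (hCan x i j).continuousAt) _
  have hcont : Continuous fun U : Matrix.unitaryGroup (Fin d × Fin d) ℂ =>
      overlapDefect (firstColumns U).1 :=
    continuous_overlapDefect.comp (continuous_subtype_val.comp continuous_firstColumns)
  have hopen : MeasurableSet {U : Matrix.unitaryGroup (Fin d × Fin d) ℂ |
      overlapDefect (firstColumns U).1 ≠ 0} := (isOpen_ne_fun hcont continuous_const).measurableSet
  have hfix : ∀ U : Matrix.unitaryGroup (Fin d × Fin d) ℂ, ∀ᵐ x : Fin m → ℝ,
      overlapDefect (firstColumns (C x * U)).1 ≠ 0 := by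
    intro U
    -- A parameter with `C x * U = c • u` is sought, so `C x` has to be `c • (u * U†)`; the phase
    -- `c` puts this matrix in the range of the Cayley transform.
    have hw : u * U.1.conjTranspose ∈ Matrix.unitaryGroup (Fin d × Fin d) ℂ :=
      mul_mem hu (Unitary.star_mem U.2)
    obtain ⟨c, hc, hcu⟩ := Matrix.exists_smul_add_one_isUnit (u * U.1.conjTranspose)
    have hcw : c • (u * U.1.conjTranspose) ∈ Matrix.unitaryGroup (Fin d × Fin d) ℂ := by
      rw [Matrix.mem_unitaryGroup_iff', star_smul, Matrix.smul_mul, Matrix.mul_smul, smul_smul,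
        Matrix.mem_unitaryGroup_iff'.1 hw]
      have : star c * c = 1 := by
        rw [← starRingEnd_apply, RCLike.conj_mul, hc]; simp
      rw [this, one_smul]
    obtain ⟨S, hS, hSw⟩ := Matrix.exists_cayley_eq hcw hcu
    obtain ⟨x, hx⟩ := hTs S hS
    refine AnalyticOnNhd.ae_ne_zero (x := x) (fun y _ => ?_) ?_
    · refine analyticAt_overlapDefect fun p k => ?_
      exact Finset.analyticAt_fun_sum _ fun j _ => (hCan y _ j).fun_mul analyticAt_const
    · have e : (C x * U).1 = c • u := by
        change Matrix.cayley (T x) * U.1 = _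
        rw [hx, hSw, Matrix.smul_mul, Matrix.mul_assoc, ← Matrix.star_eq_conjTranspose,
          Matrix.UnitaryGroup.star_mul_self, mul_one]
      change overlapDefect ((C x * U).1.submatrix id _) ≠ 0
      rw [e]
      exact hu0 c
  have hmeas : MeasurableSet {p : Matrix.unitaryGroup (Fin d × Fin d) ℂ × (Fin m → ℝ) |
      overlapDefect (firstColumns (C p.2 * p.1)).1 ≠ 0} :=
    (isOpen_ne_fun (hcont.comp ((hC.comp continuous_snd).mul continuous_fst))
      continuous_const).measurableSet
  have hswap : ∀ᵐ x : Fin m → ℝ, ∀ᵐ U ∂haarUnitary d,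
      overlapDefect (firstColumns (C x * U)).1 ≠ 0 :=
    (Measure.ae_ae_comm hmeas).1 (Eventually.of_forall hfix)
  obtain ⟨x, hx⟩ := hswap.exists
  -- The law of `C x * U` is again Haar measure, so the fixed factor `C x` can be dropped.
  rwa [← map_mul_left_eq_self (haarUnitary d) (C x),
    ae_map_iff (continuous_const_mul _).measurable.aemeasurable hopen]

end ThompsonTree

end

theorem theorem1 (d : ℕ) (hd : 2 ≤ d) :
    ∀ᵐ V ∂(ThompsonTree.haarIsometry d), ThompsonTree.WeaklyDiscontinuousAtId V := by
  have hm : MeasurableSet {V : ThompsonTree.SpinIsometry d | ThompsonTree.overlapDefect V.1 ≠ 0} :=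
    (isOpen_ne_fun (ThompsonTree.continuous_overlapDefect.comp continuous_subtype_val)
      continuous_const).measurableSet
  have h : ∀ᵐ V ∂(ThompsonTree.haarIsometry d), ThompsonTree.overlapDefect V.1 ≠ 0 := by
    rw [ThompsonTree.haarIsometry,
      ae_map_iff ThompsonTree.continuous_firstColumns.measurable.aemeasurable hm]
    exact ThompsonTree.ae_haarUnitary_overlapDefect hd
  filter_upwards [h] with V hV
  exact ThompsonTree.weaklyDiscontinuousAtId_of_overlapDefect (by omega) V hV
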